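/- **Setting.** There are finitely many agents $i$, each with a nonnegative value $v_i$. The environment is deterministic: a nonempty set $\mathcal X\subseteq\{0,1\}^n$ of feasible allocations that is downward closed ($x\in\mathcal X\Rightarrow(0,x_{-i})\in\mathcal X$). A mechanism $M$ has action spaces $A_i$, an allocation rule $\tilde x$ (mapping each action profile to a feasible allocation or a lottery over feasible allocations) and a real-valued payment rule $\tilde p$. An equilibrium is a joint distribution $\mathcal G$ of values $v$ and actions $a$; $\mathrm{Rev}(M,\mathcal G)=\mathbb E[\sum_i\tilde p_i(a)]$. We consider $\mathcal G$ with independent values and no bidder communication: the pairs $(v_i,a_i)$ are mutually independent. All expected payments are assumed to exist: $\tilde p_i(a)$ is integrable, and so is $\tilde p_i(a_i',a_{-i})$ for each fixed action $a_i'$. For an action $a_i$ let $\tilde x_i(a_i)=\mathbb E_{a_{-i}}[\tilde x_i(a_i,a_{-i})]$, $\tilde p_i(a_i)=\mathbb E_{a_{-i}}[\tilde p_i(a_i,a_{-i})]$ and let the price per unit be $\beta_i(a_i)=\tilde p_i(a_i)/\tilde x_i(a_i)$ (if $\tilde x_i(a_i)=0$: $-\infty$ when $\tilde p_i(a_i)<0$,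 and $+\infty$ otherwise). **Weak competitive efficiency.** For minimum costs $r_i\ge 0$ let $\tau_i(x)=\inf\{\beta_i(a_i):\tilde x_i(a_i)\ge x\}$ (with $\inf\emptyset=+\infty$), $\tau_i^{r_i}(x)=\tau_i(x)$ if $\tau_i(x)>r_i$ and $\tau_i^{r_i}(x)=0$ otherwise, and $T_i^{r_i}(y)=\int_0^y\tau_i^{r_i}(x)\,dx$. The mechanism $M$ has weak competitive efficiency $\mu$ for minimum costs $r$ if $\mathrm{Rev}(M,\mathcal G)\ge\mu\sum_iT_i^{r_i}(y_i)$ for every such $\mathcal G$ and every $y\in\mathcal X$. **Values.** The law $F_i$ of $v_i$ is regular: it has a density $f_i$ that is positive on an interval in $[0,\infty)$ and zero outside of it, and the virtual value $\phi_i(v)=v-(1-F_i(v))/f_i(v)$ is nondecreasing on that interval. It also has finite mean. A monopoly reserve $r_i^*\geq 0$ is a maximizer of $p\cdot\Pr[v_i\ge p]$ over $p\ge 0$. **Theorem.** Let $M$ have weak competitive efficiency $\mu\le 1$ for minimum costs $r_i=r_i^*$. Let $\mathcal G$ be an equilibrium with independent regular values of finite mean and no bidder communication that satisfies best response: for each agent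 $i$, (almost) every value $v_i$ and every action $a_i'$, $\mathbb E[v_i\tilde x_i(a)-\tilde p_i(a)\mid v_i]\ge\mathbb E[v_i\tilde x_i(a_i',a_{-i})-\tilde p_i(a_i',a_{-i})\mid v_i]$. Suppose that $\mathcal G$ respects reserves: for all $i$, with probability $1$, $v_i\ge r_i^*$ implies $\beta_i(a_i)\ge r_i^*$, and $v_i<r_i^*$ implies $\tilde x_i(a_i)=0$. Then $$\mathrm{Rev}(M,\mathcal G)\;\ge\;\frac{e-1}{2e}\,\mu\cdot\mathrm{OPT},$$ where $\mathrm{OPT}$ is the optimal (Myerson) revenue: the supremum of the expected revenues of all Bayesian incentive compatible, interim individually rational direct mechanisms whose allocations are lotteries over $\mathcal X$, for the given product distribution of values. -/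

import Mathlib

open MeasureTheory ProbabilityTheory
open scoped ENNReal NNReal

noncomputable section

namespace RobustAuction

/-- A feasibility environment for the agents `ι`: a nonempty downward-closed set of profiles of
allocation levels in `[0,1]`. -/
structure Environment (ι : Type*) [DecidableEq ι] where
  feasible : Set (ι → ℝ)
  nonempty : feasible.Nonempty
  mem_unit : ∀ x ∈ feasible, ∀ i, x i ∈ Set.Icc (0 : ℝ) 1
  downwardClosed : ∀ x ∈ feasible, ∀ i, Function.update x i 0 ∈ feasible

/-- Every feasible allocation either serves an agent or does not: `𝒳 ⊆ {0,1}ⁿ`. -/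
def Environment.IsDeterministic {ι : Type*} [DecidableEq ι] (X : Environment ι) : Prop :=
  ∀ x ∈ X.feasible, ∀ i, x i = 0 ∨ x i = 1

/-- A mechanism for single-parameter agents with action spaces `A i`. Allocation levels are
probabilities of service, so an action profile leads to a feasible allocation or to a lottery over
feasible allocations. Payments are arbitrary reals. -/
structure Mechanism {ι : Type*} [DecidableEq ι] (A : ι → Type*) [∀ i, MeasurableSpace (A i)]
    (X : Environment ι) where
  alloc : (∀ i, A i) → ι → ℝ
  pay : (∀ i, A i) → ι → ℝ
  measurable_alloc : ∀ i, Measurable fun a => alloc a i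
  measurable_pay : ∀ i, Measurable fun a => pay a i
  alloc_mem : ∀ a, alloc a ∈ convexHull ℝ X.feasible

section Outcomes

variable {ι : Type*} [Fintype ι] [DecidableEq ι] {A : ι → Type*} [∀ i, MeasurableSpace (A i)]
  {X : Environment ι}

/-- Expected revenue when values and actions are drawn from `G`. -/
def Mechanism.revenue (M : Mechanism A X) (G : Measure ((ι → ℝ) × (∀ i, A i))) : ℝ :=
  ∫ ω, ∑ i, M.pay ω.2 i ∂G

/-- Utility of agent `i` with value `v` when the action profile is `a`. -/
def Mechanism.utility (M : Mechanism A X) (i : ι) (v : ℝ) (a : ∀ i, A i) : ℝ :=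
  v * M.alloc a i - M.pay a i

/-- Independent values and no bidder communication: the pairs (value, action) of the agents are
mutually independent. Equivalently, the values are independent, and each agent chooses the action
from the own value and private randomness only. -/
def NoBidderCommunication (G : Measure ((ι → ℝ) × (∀ i, A i))) : Prop :=
  iIndepFun (fun i (ω : (ι → ℝ) × (∀ i, A i)) => (ω.1 i, ω.2 i)) G

/-- Expected payments exist, on path and for every action that an agent may deviate to. -/
def Mechanism.PaymentsIntegrable (M : Mechanism A X)
    (G : Measure ((ι → ℝ) × (∀ i, A i))) : Prop :=
  (∀ i, Integrable (fun ω => M.pay ω.2 i) G) ∧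
    ∀ i (a : A i), Integrable (fun ω => M.pay (Function.update ω.2 i a) i) G

/-- A joint distribution of nonnegative values and of actions, with independent values and no
bidder communication, for which expected payments in `M` exist. -/
structure Mechanism.IsIndependentOutcome (M : Mechanism A X)
    (G : Measure ((ι → ℝ) × (∀ i, A i))) : Prop where
  isProbabilityMeasure : IsProbabilityMeasure G
  nonneg : ∀ i, ∀ᵐ ω ∂G, 0 ≤ ω.1 i
  noBidderCommunication : NoBidderCommunication G
  paymentsIntegrable : M.PaymentsIntegrable G

/-- Best response: given the own value, no agent gains in expectation by deviating to a fixed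
action; both sides are conditional expectations given the value of agent `i`. -/
def Mechanism.SatisfiesBestResponse (M : Mechanism A X)
    (G : Measure ((ι → ℝ) × (∀ i, A i))) : Prop :=
  ∀ i (a : A i),
    condExp (MeasurableSpace.comap (fun ω : (ι → ℝ) × (∀ i, A i) => ω.1 i) inferInstance) G
        (fun ω => M.utility i (ω.1 i) (Function.update ω.2 i a))
      ≤ᵐ[G]
    condExp (MeasurableSpace.comap (fun ω : (ι → ℝ) × (∀ i, A i) => ω.1 i) inferInstance) G
        (fun ω => M.utility i (ω.1 i) ω.2)

/-- Interim allocation of action `a` of agent `i`: the expectation over the actions of the others.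
Without bidder communication it does not depend on the value of `i`. -/
def Mechanism.interimAlloc (M : Mechanism A X) (G : Measure ((ι → ℝ) × (∀ i, A i)))
    (i : ι) (a : A i) : ℝ :=
  ∫ ω, M.alloc (Function.update ω.2 i a) i ∂G

/-- Interim payment of action `a` of agent `i`. -/
def Mechanism.interimPay (M : Mechanism A X) (G : Measure ((ι → ℝ) × (∀ i, A i)))
    (i : ι) (a : A i) : ℝ :=
  ∫ ω, M.pay (Function.update ω.2 i a) i ∂G

/-- Price per unit of allocation. For an action with interim allocation `0` it is `-∞` if the
interim payment is negative and `+∞` otherwise. -/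
def Mechanism.pricePerUnit (M : Mechanism A X) (G : Measure ((ι → ℝ) × (∀ i, A i)))
    (i : ι) (a : A i) : EReal :=
  if M.interimAlloc G i a = 0 then (if M.interimPay G i a < 0 then ⊥ else ⊤)
  else ((M.interimPay G i a / M.interimAlloc G i a : ℝ) : EReal)

/-- Interim threshold cost of allocation `x` for cost function `β`; it is `+∞` when no action
secures `x`. -/
def Mechanism.thresholdCost (M : Mechanism A X) (G : Measure ((ι → ℝ) × (∀ i, A i)))
    (i : ι) (β : A i → EReal) (x : ℝ) : EReal :=
  ⨅ a ∈ {a : A i | x ≤ M.interimAlloc G i a}, β a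

/-- Interim threshold cost with discounted reserve: only costs that exceed the minimum cost `r`
count. -/
def Mechanism.discountedThresholdCost (M : Mechanism A X)
    (G : Measure ((ι → ℝ) × (∀ i, A i))) (i : ι) (β : A i → EReal) (r : ℝ≥0) (x : ℝ) : ℝ≥0∞ :=
  if ((r : ℝ) : EReal) < M.thresholdCost G i β x then (M.thresholdCost G i β x).toENNReal else 0

/-- Generalized threshold surplus with discounted reserve for allocation `y`. -/
def Mechanism.thresholdSurplus (M : Mechanism A X)
    (G : Measure ((ι → ℝ) × (∀ i, A i))) (i : ι) (β : A i → EReal) (r : ℝ≥0) (y : ℝ) : ℝ≥0∞ :=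
  ∫⁻ x in Set.Ioc 0 y, M.discountedThresholdCost G i β r x

/-- `M` has weak competitive efficiency (at least) `μ` for the cost functions `β`, which may depend
on the joint distribution, and the minimum costs `r`: on every joint distribution with independent
values and no bidder communication, and for every feasible allocation, the revenue is at least a
`μ` fraction of the threshold surplus. -/
def Mechanism.HasWeakCompetitiveEfficiency (M : Mechanism A X)
    (β : Measure ((ι → ℝ) × (∀ i, A i)) → ∀ i, A i → EReal) (r : ι → ℝ≥0) (μ : ℝ) : Prop :=
  ∀ G : Measure ((ι → ℝ) × (∀ i, A i)), M.IsIndependentOutcome G →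
    ∀ y ∈ X.feasible,
      (μ : EReal) * ((∑ i, M.thresholdSurplus G i (β G i) (r i) (y i) : ℝ≥0∞) : EReal)
        ≤ (M.revenue G : EReal)

/-- `G` respects the reserves `r`: with probability one, an agent whose value is at least the
reserve plays an action with price per unit at least the reserve, and an agent whose value is below
the reserve is not served. -/
def Mechanism.RespectsReserves (M : Mechanism A X)
    (G : Measure ((ι → ℝ) × (∀ i, A i))) (r : ι → ℝ≥0) : Prop :=
  ∀ i, ∀ᵐ ω ∂G,
    ((r i : ℝ) ≤ ω.1 i → ((r i : ℝ) : EReal) ≤ M.pricePerUnit G i (ω.2 i)) ∧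
      (ω.1 i < (r i : ℝ) → M.interimAlloc G i (ω.2 i) = 0)

end Outcomes

/-- The virtual value `v - (1 - F(v)) / f(v)` for the distribution `F` with density `f`. -/
def virtualValue (F : Measure ℝ) (f : ℝ → ℝ) (v : ℝ) : ℝ :=
  v - (1 - F.real (Set.Iic v)) / f v

/-- A regular value distribution: it has a density that is positive on an interval of nonnegative
values and zero elsewhere, and the virtual value is nondecreasing on that interval. -/
def IsRegular (F : Measure ℝ) : Prop :=
  ∃ (I : Set ℝ) (f : ℝ → ℝ), I.OrdConnected ∧ I ⊆ Set.Ici 0 ∧ Measurable f ∧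
    (∀ v ∈ I, 0 < f v) ∧
    F = volume.withDensity (fun v => ENNReal.ofReal (I.indicator f v)) ∧
    MonotoneOn (virtualValue F f) I

/-- `r` is a monopoly reserve for `F`: posting the price `r` to one agent with value drawn from `F`
maximizes the expected revenue. -/
def IsMonopolyReserve (F : Measure ℝ) (r : ℝ≥0) : Prop :=
  ∀ p : ℝ, 0 ≤ p → p * F.real (Set.Ici p) ≤ r * F.real (Set.Ici (r : ℝ))

/-- A direct mechanism: agents report values; allocations are lotteries over feasible
allocations. -/
structure DirectMechanism {ι : Type*} [DecidableEq ι] (X : Environment ι) where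
  alloc : (ι → ℝ) → ι → ℝ
  pay : (ι → ℝ) → ι → ℝ
  measurable_alloc : ∀ i, Measurable fun v => alloc v i
  measurable_pay : ∀ i, Measurable fun v => pay v i
  alloc_mem : ∀ v, alloc v ∈ convexHull ℝ X.feasible

section Optimal

variable {ι : Type*} [Fintype ι] [DecidableEq ι] {X : Environment ι}

/-- Expected utility of agent `i` with value `v` who reports `w`, when the others report
truthfully and the values follow the product distribution `F`. -/
def DirectMechanism.interimUtility (D : DirectMechanism X) (F : Measure (ι → ℝ)) (i : ι)
    (v w : ℝ) : ℝ :=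
  v * (∫ u, D.alloc (Function.update u i w) i ∂F) - ∫ u, D.pay (Function.update u i w) i ∂F

/-- Bayesian incentive compatibility (for almost all values and reports). -/
def DirectMechanism.IsBIC (D : DirectMechanism X) (F : Measure (ι → ℝ)) : Prop :=
  ∀ i, ∀ᵐ v ∂(F.map fun u => u i), ∀ᵐ w ∂(F.map fun u => u i),
    D.interimUtility F i v w ≤ D.interimUtility F i v v

/-- Interim individual rationality (for almost all values). -/
def DirectMechanism.IsIR (D : DirectMechanism X) (F : Measure (ι → ℝ)) : Prop :=
  ∀ i, ∀ᵐ v ∂(F.map fun u => u i), 0 ≤ D.interimUtility F i v v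

/-- The optimal (Myerson) revenue for the product distribution `F`: the supremum of the expected
revenues of the Bayesian incentive compatible, individually rational direct mechanisms. -/
def optimalRevenue (X : Environment ι) (F : Measure (ι → ℝ)) : EReal :=
  sSup {R : EReal | ∃ D : DirectMechanism X,
    (∀ i, Integrable (fun v => D.pay v i) F) ∧ D.IsBIC F ∧ D.IsIR F ∧
      R = ((∫ v, ∑ i, D.pay v i ∂F : ℝ) : EReal)}

end Optimal

end RobustAuction

end

/-!
The proof compares the revenue of the equilibrium with the optimal revenue through virtual values
`φᵢ(v) = v - (1 - Fᵢ(v)) / fᵢ(v)`.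

Best response means that almost every type picks an optimal action from the menu of
interim allocation-payment pairs. The indirect utility `h` of a menu is convex, so by the envelope
theorem (`ae_envelope`) almost every type `v` receives the allocation `h'(v)` and pays
`v h'(v) - h(v)`, whichever optimal action is played. Integration by parts
(`IsRegularWith.integral_integral_eq`) turns the expected payment into the virtual surplus
`𝔼[φ(v) h'(v)]` less the utility of the lowest type (`IsIndirectUtility.integral_payment`). This
gives two bounds.

* In an individually rational direct mechanism the lowest type has nonnegative utility, so the
  optimal revenue is at most the virtual surplus of some allocation
  (`DirectMechanism.integral_pay_le`).
* In an equilibrium that respects reserves the type at the monopoly reserve pays at least its value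
  per unit, so the lowest type has utility at most zero. Since `φᵢ` is nonnegative above the reserve
  and nobody is served below it, the revenue is at least `∑ 𝔼[φᵢ⁺ x̃ᵢ]`
  (`IsIndirectUtility.le_integral_payment`).

It remains to bound the virtual surplus of an arbitrary feasible allocation `y`. If an agent with
value `v` gets utility `u ≤ (v - r) x`, then obtaining `z` costs at least `v - u / z` per unit.
Integrating this over the `z` for which it exceeds the reserve gives
`φ x + T(1) ≥ (1 - 1/e) φ` (`virtualValue_covering`). Summing over the agents,
`∑ φᵢ⁺ x̃ᵢ + ∑ Tᵢ(yᵢ) ≥ (1 - 1/e) ∑ φᵢ⁺ yᵢ`, where `∑ Tᵢ(yᵢ) ≤ Rev / μ` by weak competitive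
efficiency. Both sides are affine in the lottery `y`, so `y` may be the allocation of the
direct mechanism, and taking expectations gives `Rev (1 + 1/μ) ≥ (1 - 1/e) OPT`.
-/

namespace RobustAuction

/-! ### Regular distributions on the line -/

/-- The data in `IsRegular`, with the support `I` and the density `f` exposed. -/
structure IsRegularWith (F : Measure ℝ) (I : Set ℝ) (f : ℝ → ℝ) : Prop where
  ordConnected : I.OrdConnected
  subset : I ⊆ Set.Ici 0
  measurable : Measurable f
  pos : ∀ v ∈ I, 0 < f v
  eq : F = volume.withDensity (fun v => ENNReal.ofReal (I.indicator f v))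
  mono : MonotoneOn (virtualValue F f) I

/-- The inverse hazard rate `(1 - F(v)) / f(v)`, the gap between value and virtual value. -/
noncomputable def inverseHazard (F : Measure ℝ) (f : ℝ → ℝ) (v : ℝ) : ℝ :=
  (1 - F.real (Set.Iic v)) / f v

lemma virtualValue_eq (F : Measure ℝ) (f : ℝ → ℝ) (v : ℝ) :
    virtualValue F f v = v - inverseHazard F f v := rfl

namespace IsRegularWith

variable {F : Measure ℝ} {I : Set ℝ} {f : ℝ → ℝ}

lemma measurableSet (h : IsRegularWith F I f) : MeasurableSet I := h.ordConnected.measurableSet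

lemma absolutelyContinuous (h : IsRegularWith F I f) : F ≪ volume := by
  rw [h.eq]; exact withDensity_absolutelyContinuous _ _

lemma nullMeasure_singleton (h : IsRegularWith F I f) (p : ℝ) : F {p} = 0 :=
  h.absolutelyContinuous (by simp)

lemma real_Ici (h : IsRegularWith F I f) (p : ℝ) : F.real (Set.Ici p) = F.real (Set.Ioi p) := by
  have : NullSingletonClass F := ⟨h.nullMeasure_singleton⟩
  exact measureReal_congr Ioi_ae_eq_Ici.symm

lemma lintegral_eq (h : IsRegularWith F I f) (g : ℝ → ℝ≥0∞) (hg : Measurable g) :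
    ∫⁻ v, g v ∂F = ∫⁻ v in I, ENNReal.ofReal (f v) * g v := by
  have hm : Measurable (fun v => ENNReal.ofReal (I.indicator f v)) :=
    (h.measurable.indicator h.measurableSet).ennreal_ofReal
  rw [h.eq, lintegral_withDensity_eq_lintegral_mul _ hm hg, ← lintegral_indicator h.measurableSet]
  congr 1; ext v
  by_cases hv : v ∈ I <;> simp [hv]

lemma ae_mem (h : IsRegularWith F I f) : ∀ᵐ v ∂F, v ∈ I := by
  have : F Iᶜ = 0 := by
    rw [h.eq, withDensity_apply _ h.measurableSet.compl]
    rw [lintegral_eq_zero_iff (h.measurable.indicator h.measurableSet).ennreal_ofReal]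
    filter_upwards [ae_restrict_mem h.measurableSet.compl] with v hv
    simp [Set.indicator_of_notMem hv]
  exact this

lemma bddBelow (h : IsRegularWith F I f) : BddBelow I := ⟨0, fun _ hv => h.subset hv⟩

lemma nonempty [IsProbabilityMeasure F] (h : IsRegularWith F I f) : I.Nonempty := by
  obtain ⟨v, hv⟩ := h.ae_mem.exists
  exact ⟨v, hv⟩

lemma sInf_nonneg [IsProbabilityMeasure F] (h : IsRegularWith F I f) : 0 ≤ sInf I :=
  le_csInf h.nonempty fun _ hv => h.subset hv

lemma ae_sInf_le (h : IsRegularWith F I f) : ∀ᵐ v ∂F, sInf I ≤ v := by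
  filter_upwards [h.ae_mem] with v hv using csInf_le h.bddBelow hv

lemma measure_Ioc_pos [IsProbabilityMeasure F] (h : IsRegularWith F I f) {p q : ℝ} (hpq : p < q)
    (hq : q ∈ I) (ha : sInf I < q) : 0 < F (Set.Ioc p q) := by
  obtain ⟨c, hc, hcq⟩ := exists_lt_of_csInf_lt h.nonempty ha
  have hsub : Set.Ioo (max p c) q ⊆ Set.Ioc p q := fun x hx =>
    ⟨(le_max_left _ _).trans_lt hx.1, hx.2.le⟩
  refine lt_of_lt_of_le ?_ (measure_mono hsub)
  have hI : ∀ x ∈ Set.Ioo (max p c) q, x ∈ I := fun x hx =>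
    h.ordConnected.out hc hq ⟨((le_max_right _ _).trans_lt hx.1).le, hx.2.le⟩
  rw [h.eq, withDensity_apply _ measurableSet_Ioo,
    setLIntegral_pos_iff (h.measurable.indicator h.measurableSet).ennreal_ofReal]
  have : Function.support (fun v => ENNReal.ofReal (I.indicator f v)) ∩ Set.Ioo (max p c) q
      = Set.Ioo (max p c) q := by
    refine Set.inter_eq_right.2 fun x hx => ?_
    simp [Set.indicator_of_mem (hI x hx), h.pos x (hI x hx)]
  rw [this]
  simp [hpq, hcq]

lemma exists_gt_sInf [IsProbabilityMeasure F] (h : IsRegularWith F I f) :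
    ∃ c ∈ I, sInf I < c := by
  by_contra! hc
  have : ∀ᵐ v ∂F, v ∈ ({sInf I} : Set ℝ) := by
    filter_upwards [h.ae_mem] with v hv
    exact le_antisymm (hc v hv) (csInf_le h.bddBelow hv)
  have h0 : F ({sInf I} : Set ℝ)ᶜ = 0 := this
  have h1 := measure_univ (μ := F)
  rw [← Set.union_compl_self ({sInf I} : Set ℝ)] at h1
  have := measure_union_le (μ := F) ({sInf I} : Set ℝ) ({sInf I} : Set ℝ)ᶜ
  rw [h0, h.nullMeasure_singleton, h1] at this
  simp at this

/-- Almost sure properties hold at points of the support arbitrarily close to `p` from the right,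
if `p` is neither below nor at the top end of the support. -/
lemma exists_mem_Ioc_of_ae [IsProbabilityMeasure F] (h : IsRegularWith F I f) {p c : ℝ}
    (hp : sInf I ≤ p) (hc : c ∈ I) (hpc : p < c) {P : ℝ → Prop} (hP : ∀ᵐ v ∂F, P v)
    {ε : ℝ} (hε : 0 < ε) : ∃ v ∈ Set.Ioc p (p + ε), P v := by
  have hq : p < min c (p + ε) := lt_min hpc (by linarith)
  obtain ⟨c', hc', hc'q⟩ := exists_lt_of_csInf_lt h.nonempty (hp.trans_lt hq)
  have hqI : min c (p + ε) ∈ I := h.ordConnected.out hc' hc ⟨hc'q.le, min_le_left _ _⟩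
  have hpos := h.measure_Ioc_pos hq hqI (hp.trans_lt hq)
  by_contra! hne
  have hz : F (Set.Ioc p (min c (p + ε))) = 0 := by
    refine measure_mono_null ?_ hP
    intro v hv
    exact hne v ⟨hv.1, hv.2.trans (min_le_right _ _)⟩
  exact hpos.ne' hz

lemma measurable_inverseHazard [IsProbabilityMeasure F] (h : IsRegularWith F I f) :
    Measurable (inverseHazard F f) := by
  have hm : Monotone fun v => F.real (Set.Iic v) := fun a b hab =>
    measureReal_mono (Set.Iic_subset_Iic.2 hab)
  exact (measurable_const.sub hm.measurable).div h.measurable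

lemma measurable_virtualValue [IsProbabilityMeasure F] (h : IsRegularWith F I f) :
    Measurable (virtualValue F f) :=
  measurable_id.sub h.measurable_inverseHazard

lemma inverseHazard_nonneg [IsProbabilityMeasure F] (h : IsRegularWith F I f) {v : ℝ} (hv : v ∈ I) :
    0 ≤ inverseHazard F f v :=
  div_nonneg (sub_nonneg.2 measureReal_le_one) (h.pos v hv).le

/-- Integration by parts against the distribution `F`: the tail `1 - F` of the layer cake formula is
the inverse hazard rate times the density. -/
lemma lintegral_integral_eq [IsProbabilityMeasure F] (h : IsRegularWith F I f) {g : ℝ → ℝ}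
    (hg : Measurable g) (g0 : ∀ t, 0 ≤ g t) (g1 : ∀ t, g t ≤ 1) :
    ∫⁻ v, ENNReal.ofReal (∫ t in sInf I..v, g t) ∂F
      = ∫⁻ v, ENNReal.ofReal (g v * inverseHazard F f v) ∂F := by
  set a := sInf I with ha
  have hint : ∀ g' : ℝ → ℝ, Measurable g' → (∀ t, 0 ≤ g' t) → (∀ t, g' t ≤ 1) →
      ∀ s t : ℝ, IntervalIntegrable g' volume s t := by
    intro g' hg' h0 h1 s t
    refine (intervalIntegrable_const (c := (1 : ℝ))).mono_fun' hg'.aestronglyMeasurable ?_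
    exact Filter.Eventually.of_forall fun x => by simpa [abs_of_nonneg (h0 x)] using h1 x
  have key := lintegral_comp_eq_lintegral_meas_lt_mul F (f := fun v => v - a)
    (g := fun t => g (a + t))
    (by filter_upwards [h.ae_sInf_le] with v hv using sub_nonneg.2 hv)
    (by fun_prop)
    (fun t _ => hint _ (by fun_prop) (fun _ => g0 _) (fun _ => g1 _) _ _)
    (Filter.Eventually.of_forall fun t => g0 _)
  have e1 : ∀ v, ∫ t in (0:ℝ)..(v - a), g (a + t) = ∫ t in a..v, g t := by
    intro v
    rw [intervalIntegral.integral_comp_add_left (fun t => g t) a]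
    simp
  simp only [e1] at key
  rw [key, h.lintegral_eq (fun v => ENNReal.ofReal (g v * inverseHazard F f v))
    (hg.mul h.measurable_inverseHazard).ennreal_ofReal]
  have e2 : ∫⁻ t in Set.Ioi (0:ℝ), F {v | t < v - a} * ENNReal.ofReal (g (a + t))
      = ∫⁻ t in Set.Ioi a, F (Set.Ioi t) * ENNReal.ofReal (g t) := by
    rw [← lintegral_indicator measurableSet_Ioi, ← lintegral_indicator measurableSet_Ioi,
      ← lintegral_add_left_eq_self ((Set.Ioi a).indicator _) a]
    congr 1; ext t
    have hs : {v | t < v - a} = Set.Ioi (a + t) := by ext v; simp [lt_sub_iff_add_lt, add_comm]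
    by_cases ht : 0 < t <;> simp [Set.indicator, ht, hs]
  rw [e2, ← lintegral_indicator measurableSet_Ioi, ← lintegral_indicator h.measurableSet]
  have hane : ∀ᵐ t : ℝ, t ≠ a := by simp [ae_iff]
  refine lintegral_congr_ae ?_
  filter_upwards [hane] with t hta
  by_cases ht : t ∈ I
  · have hat : a < t := lt_of_le_of_ne (csInf_le h.bddBelow ht) (Ne.symm hta)
    have htail : F (Set.Ioi t) = ENNReal.ofReal (1 - F.real (Set.Iic t)) := by
      rw [← probReal_compl_eq_one_sub measurableSet_Iic, Set.compl_Iic, ofReal_measureReal]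
    have hf := h.pos t ht
    rw [Set.indicator_of_mem ht, Set.indicator_of_mem (Set.mem_Ioi.2 hat), htail,
      ← ENNReal.ofReal_mul (sub_nonneg.2 measureReal_le_one), ← ENNReal.ofReal_mul hf.le]
    congr 1
    unfold inverseHazard
    field_simp
  · rw [Set.indicator_of_notMem ht]
    by_cases hat : a < t
    · rw [Set.indicator_of_mem (Set.mem_Ioi.2 hat)]
      have : F (Set.Ioi t) = 0 := by
        refine measure_mono_null ?_ h.ae_mem
        intro v hv hvI
        obtain ⟨c, hc, hct⟩ := exists_lt_of_csInf_lt h.nonempty hat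
        exact ht (h.ordConnected.out hc hvI ⟨hct.le, hv.le⟩)
      simp [this]
    · rw [Set.indicator_of_notMem (by simpa using hat)]

lemma integrable_inverseHazard [IsProbabilityMeasure F] (h : IsRegularWith F I f)
    (hF : Integrable (fun v => v) F) : Integrable (inverseHazard F f) F := by
  refine ⟨h.measurable_inverseHazard.aestronglyMeasurable, ?_⟩
  rw [hasFiniteIntegral_iff_ofReal (by
    filter_upwards [h.ae_mem] with v hv using h.inverseHazard_nonneg hv)]
  have := h.lintegral_integral_eq (g := fun _ => 1) measurable_const (by simp) (by simp)
  simp only [one_mul, intervalIntegral.integral_const, smul_eq_mul, mul_one] at this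
  rw [← this]
  exact (hF.sub (integrable_const _)).lintegral_lt_top

lemma integrable_virtualValue [IsProbabilityMeasure F] (h : IsRegularWith F I f)
    (hF : Integrable (fun v => v) F) : Integrable (virtualValue F f) F :=
  hF.sub (h.integrable_inverseHazard hF)

lemma integral_integral_eq [IsProbabilityMeasure F] (h : IsRegularWith F I f)
    {g : ℝ → ℝ}
    (hg : Measurable g) (g0 : ∀ t, 0 ≤ g t) (g1 : ∀ t, g t ≤ 1) :
    ∫ v, (∫ t in sInf I..v, g t) ∂F = ∫ v, g v * inverseHazard F f v ∂F := by
  have hgi : ∀ s t, IntervalIntegrable g volume s t := fun s t => by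
    refine (intervalIntegrable_const (c := (1 : ℝ))).mono_fun' hg.aestronglyMeasurable ?_
    exact Filter.Eventually.of_forall fun x => by simpa [abs_of_nonneg (g0 x)] using g1 x
  rw [integral_eq_lintegral_of_nonneg_ae, integral_eq_lintegral_of_nonneg_ae,
    h.lintegral_integral_eq hg g0 g1]
  · filter_upwards [h.ae_mem] with v hv using mul_nonneg (g0 v) (h.inverseHazard_nonneg hv)
  · exact (hg.mul h.measurable_inverseHazard).aestronglyMeasurable
  · filter_upwards [h.ae_sInf_le] with v hv
    exact intervalIntegral.integral_nonneg hv fun t _ => g0 t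
  · exact (intervalIntegral.continuous_primitive hgi _).measurable.aestronglyMeasurable

/-- The revenue of a posted price is the virtual surplus it generates. -/
lemma setIntegral_Ioi_virtualValue [IsProbabilityMeasure F] (h : IsRegularWith F I f)
    (hF : Integrable (fun v => v) F) {p : ℝ} (hp : sInf I ≤ p) :
    ∫ v in Set.Ioi p, virtualValue F f v ∂F = p * F.real (Set.Ioi p) := by
  have key := h.integral_integral_eq (g := (Set.Ioi p).indicator 1)
    (measurable_one.indicator measurableSet_Ioi)
    (fun t => Set.indicator_nonneg (by simp) t) (fun t => Set.indicator_le_self' (by simp) t)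
  have e1 : ∀ v, sInf I ≤ v → ∫ t in sInf I..v, (Set.Ioi p).indicator (1 : ℝ → ℝ) t
      = (Set.Ioi p).indicator (fun v => v - p) v := by
    intro v hv
    rw [intervalIntegral.integral_of_le hv, setIntegral_indicator measurableSet_Ioi]
    have : Set.Ioc (sInf I) v ∩ Set.Ioi p = Set.Ioc p v := by
      ext t; simp only [Set.mem_inter_iff, Set.mem_Ioc, Set.mem_Ioi]
      constructor
      · rintro ⟨⟨_, h2⟩, h3⟩; exact ⟨h3, h2⟩
      · rintro ⟨h1, h2⟩; exact ⟨⟨hp.trans_lt h1, h2⟩, h1⟩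
    rw [this]
    by_cases hpv : p < v
    · simp [hpv, hpv.le]
    · simp [hpv]
  have e2 : ∫ v, (∫ t in sInf I..v, (Set.Ioi p).indicator (1 : ℝ → ℝ) t) ∂F
      = ∫ v in Set.Ioi p, (v - p) ∂F := by
    rw [← integral_indicator measurableSet_Ioi]
    refine integral_congr_ae ?_
    filter_upwards [h.ae_sInf_le] with v hv using e1 v hv
  have e3 : ∫ v, (Set.Ioi p).indicator (1 : ℝ → ℝ) v * inverseHazard F f v ∂F
      = ∫ v in Set.Ioi p, inverseHazard F f v ∂F := by
    rw [← integral_indicator measurableSet_Ioi]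
    congr 1; ext v
    by_cases hv : p < v <;> simp [hv]
  rw [e2, e3, integral_sub hF.integrableOn (integrable_const _)] at key
  simp only [virtualValue_eq]
  rw [integral_sub hF.integrableOn (h.integrable_inverseHazard hF).integrableOn, ← key]
  simp [mul_comm]

lemma setIntegral_Ioc_virtualValue [IsProbabilityMeasure F] (h : IsRegularWith F I f)
    (hF : Integrable (fun v => v) F) {p q : ℝ} (hp : sInf I ≤ p) (hpq : p ≤ q) :
    ∫ v in Set.Ioc p q, virtualValue F f v ∂F
      = p * F.real (Set.Ici p) - q * F.real (Set.Ici q) := by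
  have := setIntegral_union (μ := F) (f := virtualValue F f) (s := Set.Ioc p q) (t := Set.Ioi q)
    (Set.disjoint_left.2 fun x hx hx' => (not_lt.2 hx.2) hx') measurableSet_Ioi
    (h.integrable_virtualValue hF).integrableOn (h.integrable_virtualValue hF).integrableOn
  rw [Set.Ioc_union_Ioi_eq_Ioi hpq, h.setIntegral_Ioi_virtualValue hF hp,
    h.setIntegral_Ioi_virtualValue hF (hp.trans hpq)] at this
  rw [h.real_Ici, h.real_Ici]
  linarith

lemma sInf_le_reserve [IsProbabilityMeasure F] (h : IsRegularWith F I f)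
    {r : ℝ≥0} (hr : IsMonopolyReserve F r) : sInf I ≤ r := by
  -- Otherwise the higher price `sInf I` would still sell with probability one.
  by_contra! hlt
  have h1 := hr (sInf I) h.sInf_nonneg
  have h2 : F.real (Set.Ici (sInf I)) = 1 := by
    have : F (Set.Ici (sInf I)) = 1 := (prob_compl_eq_zero_iff measurableSet_Ici).1 h.ae_sInf_le
    simp [Measure.real, this]
  have h3 : F.real (Set.Ici (r:ℝ)) ≤ 1 := measureReal_le_one
  have h4 := mul_le_mul_of_nonneg_left h3 r.2
  rw [h2] at h1
  simp at h4
  linarith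

lemma exists_gt_reserve [IsProbabilityMeasure F] (h : IsRegularWith F I f)
    {r : ℝ≥0} (hr : IsMonopolyReserve F r) : ∃ c ∈ I, (r : ℝ) < c := by
  by_contra! hle
  have h0 : F.real (Set.Ici (r:ℝ)) = 0 := by
    rw [h.real_Ici, measureReal_eq_zero_iff]
    refine measure_mono_null ?_ h.ae_mem
    intro v hv hvI
    exact absurd hv (not_lt.2 (hle v hvI))
  obtain ⟨c, hc, hac⟩ := h.exists_gt_sInf
  have hm : sInf I < (sInf I + c) / 2 := by linarith
  have hp := h.measure_Ioc_pos (p := (sInf I + c) / 2) (by linarith) hc hac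
  have hm0 : 0 < (sInf I + c) / 2 := h.sInf_nonneg.trans_lt hm
  have h1 := hr _ hm0.le
  rw [h0, mul_zero] at h1
  have : 0 < F.real (Set.Ici ((sInf I + c) / 2)) := by
    refine ENNReal.toReal_pos (ne_of_gt (hp.trans_le (measure_mono ?_))) (measure_ne_top _ _)
    intro v hv
    exact hv.1.le
  nlinarith [mul_pos hm0 this]

/-- By `setIntegral_Ioc_virtualValue` a negative virtual value above the reserve, which by
regularity would be negative all the way down to the reserve, would make a higher price more
profitable. -/
lemma virtualValue_nonneg [IsProbabilityMeasure F] (h : IsRegularWith F I f)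
    (hF : Integrable (fun v => v) F) {r : ℝ≥0} (hr : IsMonopolyReserve F r) {v : ℝ}
    (hv : v ∈ I) (hrv : r < v) : 0 ≤ virtualValue F f v := by
  by_contra! hneg
  have har := h.sInf_le_reserve hr
  have h1 := h.setIntegral_Ioc_virtualValue hF har hrv.le
  have h2 := hr v (r.2.trans hrv.le)
  have h3 : ∫ t in Set.Ioc (r:ℝ) v, virtualValue F f t ∂F
      ≤ ∫ t in Set.Ioc (r:ℝ) v, virtualValue F f v ∂F := by
    refine setIntegral_mono_on_ae (h.integrable_virtualValue hF).integrableOn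
      (integrable_const _) measurableSet_Ioc ?_
    filter_upwards [h.ae_mem] with t ht htI using h.mono ht hv htI.2
  have h4 : 0 < F.real (Set.Ioc (r:ℝ) v) := ENNReal.toReal_pos
    (h.measure_Ioc_pos hrv hv (har.trans_lt hrv)).ne' (measure_ne_top _ _)
  rw [setIntegral_const, smul_eq_mul] at h3
  nlinarith [mul_neg_of_pos_of_neg h4 hneg]

lemma virtualValue_nonpos [IsProbabilityMeasure F] (h : IsRegularWith F I f)
    (hF : Integrable (fun v => v) F) {r : ℝ≥0} (hr : IsMonopolyReserve F r) {v : ℝ}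
    (hv : v ∈ I) (hrv : v < r) : virtualValue F f v ≤ 0 := by
  by_contra! hpos
  have hav : sInf I ≤ v := csInf_le h.bddBelow hv
  obtain ⟨c, hc, hrc⟩ := h.exists_gt_reserve hr
  have hrI : (r : ℝ) ∈ I := h.ordConnected.out hv hc ⟨hrv.le, hrc.le⟩
  have h1 := h.setIntegral_Ioc_virtualValue hF hav hrv.le
  have h2 := hr v (h.subset hv)
  have h3 : ∫ t in Set.Ioc v (r:ℝ), virtualValue F f v ∂F
      ≤ ∫ t in Set.Ioc v (r:ℝ), virtualValue F f t ∂F := by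
    refine setIntegral_mono_on_ae (integrable_const _)
      (h.integrable_virtualValue hF).integrableOn measurableSet_Ioc ?_
    filter_upwards [h.ae_mem] with t ht htI using h.mono hv ht htI.1.le
  have h4 : 0 < F.real (Set.Ioc v (r:ℝ)) := ENNReal.toReal_pos
    (h.measure_Ioc_pos hrv hrI (hav.trans_lt hrv)).ne' (measure_ne_top _ _)
  rw [setIntegral_const, smul_eq_mul] at h3
  nlinarith [mul_pos h4 hpos]

end IsRegularWith

/-! ### Indirect utilities and virtual surplus -/

/-- The properties of an indirect utility `v ↦ sup (v x - p)` with allocations `x ∈ [0,1]` that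
the revenue formula uses. -/
structure IsIndirectUtility (h : ℝ → ℝ) : Prop where
  monotone : Monotone h
  lipschitz : LipschitzWith 1 h

namespace IsIndirectUtility

variable {h : ℝ → ℝ}

lemma deriv_nonneg (hh : IsIndirectUtility h) (v : ℝ) : 0 ≤ deriv h v := hh.monotone.deriv_nonneg

lemma deriv_le_one (hh : IsIndirectUtility h) (v : ℝ) : deriv h v ≤ 1 :=
  (le_abs_self _).trans (by simpa using norm_deriv_le_of_lipschitz hh.lipschitz (x₀ := v))

lemma integral_deriv (hh : IsIndirectUtility h) (a v : ℝ) :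
    ∫ t in a..v, deriv h t = h v - h a :=
  (hh.lipschitz.lipschitzOnWith.absolutelyContinuousOnInterval).integral_deriv_eq_sub

lemma sub_le (hh : IsIndirectUtility h) {a v : ℝ} (hav : a ≤ v) : h v - h a ≤ v - a := by
  have := hh.lipschitz.dist_le_mul v a
  simp only [Real.dist_eq, NNReal.coe_one, one_mul, abs_of_nonneg (sub_nonneg.2 hav)] at this
  exact (le_abs_self _).trans this

variable {F : Measure ℝ} {I : Set ℝ} {f : ℝ → ℝ}

lemma integrable [IsProbabilityMeasure F] (hh : IsIndirectUtility h)
    (hF : Integrable (fun v => v) F) : Integrable h F := by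
  refine ((integrable_const |h 0|).add hF.abs).mono'
    hh.lipschitz.continuous.measurable.aestronglyMeasurable
    (Filter.Eventually.of_forall fun v => ?_)
  have := hh.lipschitz.dist_le_mul v 0
  simp only [Real.dist_eq, NNReal.coe_one, one_mul, sub_zero] at this
  have h2 := abs_sub_abs_le_abs_sub (h v) (h 0)
  simp only [Real.norm_eq_abs, Pi.add_apply]
  linarith

lemma integrable_mul_deriv (hh : IsIndirectUtility h) {g : ℝ → ℝ}
    (hF : Integrable g F) : Integrable (fun v => g v * deriv h v) F := by
  refine hF.mul_bdd (c := 1) (measurable_deriv h).aestronglyMeasurable ?_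
  exact Filter.Eventually.of_forall fun v => by
    simpa [abs_of_nonneg (hh.deriv_nonneg v)] using hh.deriv_le_one v

/-- Revenue equivalence: the expected payment `v h'(v) - h(v)` is the expected virtual surplus less
the utility of the lowest type. -/
lemma integral_payment [IsProbabilityMeasure F] (hh : IsIndirectUtility h)
    (hreg : IsRegularWith F I f) (hF : Integrable (fun v => v) F) :
    ∫ v, (v * deriv h v - h v) ∂F = ∫ v, virtualValue F f v * deriv h v ∂F - h (sInf I) := by
  have key := hreg.integral_integral_eq (measurable_deriv h) hh.deriv_nonneg hh.deriv_le_one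
  simp only [hh.integral_deriv] at key
  rw [integral_sub (hh.integrable hF) (integrable_const _)] at key
  simp only [virtualValue_eq, sub_mul]
  rw [integral_sub (hh.integrable_mul_deriv hF) (hh.integrable hF),
    integral_sub (hh.integrable_mul_deriv hF)
      (hh.integrable_mul_deriv (hreg.integrable_inverseHazard hF))]
  simp only [integral_const, probReal_univ, one_smul] at key
  simp only [mul_comm (inverseHazard F f _)]
  linarith

/-- Utilities that are nonnegative almost surely are nonnegative at the lowest type, so payments are
at most the virtual surplus. -/
lemma integral_payment_le [IsProbabilityMeasure F] (hh : IsIndirectUtility h)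
    (hreg : IsRegularWith F I f) (hF : Integrable (fun v => v) F) (h0 : ∀ᵐ v ∂F, 0 ≤ h v) :
    ∫ v, (v * deriv h v - h v) ∂F ≤ ∫ v, max (virtualValue F f v) 0 * deriv h v ∂F := by
  have ha : 0 ≤ h (sInf I) := by
    by_contra! hneg
    obtain ⟨c, hc, hac⟩ := hreg.exists_gt_sInf
    obtain ⟨v, hv, hv0⟩ := hreg.exists_mem_Ioc_of_ae le_rfl hc hac h0
      (ε := - h (sInf I) / 2) (by linarith)
    have := hh.sub_le hv.1.le
    linarith [hv.2]
  rw [hh.integral_payment hreg hF]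
  have : ∫ v, virtualValue F f v * deriv h v ∂F ≤ ∫ v, max (virtualValue F f v) 0 * deriv h v ∂F :=
    integral_mono (hh.integrable_mul_deriv (hreg.integrable_virtualValue hF))
      (hh.integrable_mul_deriv (hreg.integrable_virtualValue hF).pos_part) fun v =>
      mul_le_mul_of_nonneg_right (le_max_left _ _) (hh.deriv_nonneg v)
  linarith

/-- If types above the reserve pay at least the reserve per unit and types below it are not served,
then the utility at the reserve, hence at the lowest type, is at most zero, so payments are at
least the virtual surplus, all of which is nonnegative. -/
lemma le_integral_payment [IsProbabilityMeasure F] (hh : IsIndirectUtility h)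
    (hreg : IsRegularWith F I f) (hF : Integrable (fun v => v) F) {r : ℝ≥0}
    (hr : IsMonopolyReserve F r) (hge : ∀ᵐ v ∂F, (r : ℝ) ≤ v → h v ≤ (v - r) * deriv h v)
    (hlt : ∀ᵐ v ∂F, v < (r : ℝ) → deriv h v = 0) :
    ∫ v, max (virtualValue F f v) 0 * deriv h v ∂F ≤ ∫ v, (v * deriv h v - h v) ∂F := by
  have har := hreg.sInf_le_reserve hr
  have hr0 : h r ≤ 0 := by
    by_contra! hpos
    obtain ⟨c, hc, hrc⟩ := hreg.exists_gt_reserve hr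
    obtain ⟨v, hv, hv0⟩ := hreg.exists_mem_Ioc_of_ae har hc hrc hge
      (ε := h r / 2) (by linarith)
    have h1 := hv0 hv.1.le
    have h2 := mul_le_mul_of_nonneg_left (hh.deriv_le_one v) (sub_nonneg.2 hv.1.le)
    have h3 := hh.monotone hv.1.le
    linarith [hv.2]
  have ha : h (sInf I) ≤ 0 := (hh.monotone har).trans hr0
  rw [hh.integral_payment hreg hF]
  have : ∫ v, max (virtualValue F f v) 0 * deriv h v ∂F
      = ∫ v, virtualValue F f v * deriv h v ∂F := by
    refine integral_congr_ae ?_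
    have hne : ∀ᵐ v ∂F, v ≠ (r : ℝ) := by
      rw [ae_iff]; simpa using hreg.nullMeasure_singleton r
    filter_upwards [hreg.ae_mem, hlt, hne] with v hv hvl hvne
    rcases lt_or_gt_of_ne hvne with hv' | hv'
    · simp [hvl hv']
    · simp [max_eq_left (hreg.virtualValue_nonneg hF hr hv hv')]
  linarith

end IsIndirectUtility

/-! ### Menus -/

/-- The indirect utility of the menu of options `b ∈ S` with allocation `g b` and payment `q b`. -/
noncomputable def menuUtility {B : Type*} (S : Set B) (g q : B → ℝ) (v : ℝ) : ℝ :=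
  ⨆ b : S, (v * g b - q b)

section Menu

variable {B : Type*} {S : Set B} {g q : B → ℝ}

/-- A countable submenu is as good as the whole menu for every value: take options whose
allocation-payment pairs are dense. -/
lemma exists_countable_submenu (S : Set B) (g q : B → ℝ) :
    ∃ C ⊆ S, C.Countable ∧
      ∀ v u : ℝ, (∀ b ∈ C, v * g b - q b ≤ u) → ∀ b ∈ S, v * g b - q b ≤ u := by
  obtain ⟨c, hcs, hc, hd⟩ := (TopologicalSpace.IsSeparable.of_separableSpace
    ((fun b => (g b, q b)) '' S)).exists_countable_dense_subset
  choose k hk using hcs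
  have := hc.to_subtype
  refine ⟨Set.range fun x : c => k x.2, ?_, Set.countable_range _, ?_⟩
  · rintro _ ⟨x, rfl⟩
    exact (hk x.2).1
  · intro v u hu b hb
    have hcl : IsClosed {x : ℝ × ℝ | v * x.1 - x.2 ≤ u} :=
      isClosed_le (by fun_prop) continuous_const
    have hsub : c ⊆ {x : ℝ × ℝ | v * x.1 - x.2 ≤ u} := by
      intro x hx
      have h1 := hu (k hx) ⟨⟨x, hx⟩, rfl⟩
      have h2 : (g (k hx), q (k hx)) = x := (hk hx).2
      rw [Set.mem_ofPred_eq, ← h2]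
      exact h1
    exact hcl.closure_subset_iff.2 hsub (hd ⟨b, hb, rfl⟩)

lemma ae_forall_menu_le {Ω : Type*} [MeasurableSpace Ω] {P : Measure Ω} {V U : Ω → ℝ}
    (h : ∀ b ∈ S, ∀ᵐ ω ∂P, V ω * g b - q b ≤ U ω) :
    ∀ᵐ ω ∂P, ∀ b ∈ S, V ω * g b - q b ≤ U ω := by
  obtain ⟨C, hCS, hC, hle⟩ := exists_countable_submenu S g q
  have : ∀ᵐ ω ∂P, ∀ b ∈ C, V ω * g b - q b ≤ U ω := (ae_ball_iff hC).2 fun b hb => h b (hCS hb)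
  filter_upwards [this] with ω hω using hle _ _ hω

lemma bddAbove_menu (g0 : ∀ b, 0 ≤ g b) (g1 : ∀ b, g b ≤ 1) {v₀ u : ℝ}
    (hu : ∀ b ∈ S, v₀ * g b - q b ≤ u) (v : ℝ) :
    BddAbove (Set.range fun b : S => v * g b - q b) := by
  refine ⟨u + |v - v₀|, ?_⟩
  rintro _ ⟨b, rfl⟩
  have h1 := hu b b.2
  have h2 : (v - v₀) * g b ≤ |v - v₀| :=
    (mul_le_mul_of_nonneg_right (le_abs_self _) (g0 _)).trans
      (mul_le_of_le_one_right (abs_nonneg _) (g1 _))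
  simp only
  linarith

lemma isIndirectUtility_menuUtility (hS : S.Nonempty) (g0 : ∀ b, 0 ≤ g b) (g1 : ∀ b, g b ≤ 1)
    {v₀ u : ℝ} (hu : ∀ b ∈ S, v₀ * g b - q b ≤ u) : IsIndirectUtility (menuUtility S g q) := by
  have : Nonempty S := hS.to_subtype
  constructor
  · intro v w hvw
    refine ciSup_mono (bddAbove_menu g0 g1 hu w) fun b => ?_
    have := mul_le_mul_of_nonneg_right hvw (g0 b)
    linarith
  · refine LipschitzWith.of_le_add fun v w => ?_
    refine ciSup_le fun b => ?_
    have h1 := le_ciSup (bddAbove_menu g0 g1 hu w) b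
    have h2 : (v - w) * g b ≤ |v - w| :=
      (mul_le_mul_of_nonneg_right (le_abs_self _) (g0 _)).trans
        (mul_le_of_le_one_right (abs_nonneg _) (g1 _))
    simp only [menuUtility, Real.dist_eq] at *
    linarith

/-- Envelope theorem: when almost every type chooses an optimal option `α` of the menu, then the
chosen allocation is the derivative of the indirect utility, which exists almost everywhere; random
choices among optimal options make no difference. -/
lemma ae_envelope {Ω : Type*} [MeasurableSpace Ω] {P : Measure Ω} [IsProbabilityMeasure P]
    {V : Ω → ℝ} {α : Ω → B} (hV : Measurable V) (hac : P.map V ≪ volume)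
    (g0 : ∀ b, 0 ≤ g b) (g1 : ∀ b, g b ≤ 1) (hα : ∀ᵐ ω ∂P, α ω ∈ S)
    (hopt : ∀ᵐ ω ∂P, ∀ b ∈ S, V ω * g b - q b ≤ V ω * g (α ω) - q (α ω)) :
    IsIndirectUtility (menuUtility S g q) ∧
      (∀ v, ∀ b ∈ S, v * g b - q b ≤ menuUtility S g q v) ∧
      ∀ᵐ ω ∂P, menuUtility S g q (V ω) = V ω * g (α ω) - q (α ω) ∧
        deriv (menuUtility S g q) (V ω) = g (α ω) := by
  obtain ⟨ω₀, h₀, hα₀⟩ := (hopt.and hα).exists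
  have hS : S.Nonempty := ⟨_, hα₀⟩
  have : Nonempty S := hS.to_subtype
  have hI := isIndirectUtility_menuUtility hS g0 g1 h₀
  have hle : ∀ v, ∀ b ∈ S, v * g b - q b ≤ menuUtility S g q v := fun v b hb =>
    le_ciSup (bddAbove_menu g0 g1 h₀ v) ⟨b, hb⟩
  refine ⟨hI, hle, ?_⟩
  have hdiff : ∀ᵐ ω ∂P, DifferentiableAt ℝ (menuUtility S g q) (V ω) :=
    ae_of_ae_map hV.aemeasurable (hac.ae_le hI.lipschitz.ae_differentiableAt_real)
  filter_upwards [hα, hopt, hdiff] with ω hω ho hd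
  have heq : menuUtility S g q (V ω) = V ω * g (α ω) - q (α ω) :=
    le_antisymm (ciSup_le fun b => ho b b.2) (hle _ _ hω)
  refine ⟨heq, ?_⟩
  -- The supporting line of the chosen option touches the indirect utility at `V ω`.
  have hmin : IsLocalMin (fun w => menuUtility S g q w - w * g (α ω)) (V ω) := by
    refine Filter.Eventually.of_forall fun w => ?_
    have := hle w _ hω
    simp only [heq]
    linarith
  have h0 := hmin.hasDerivAt_eq_zero
    (hd.hasDerivAt.sub ((hasDerivAt_id (V ω)).mul_const (g (α ω))))
  simp only [one_mul] at h0
  linarith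

end Menu

/-! ### Resampling a coordinate of a product distribution -/

section Resample

variable {ι : Type*} [Fintype ι] [DecidableEq ι] {B : ι → Type*} [∀ i, MeasurableSpace (B i)]

/-- Replacing one coordinate of a sample from a product distribution by that of an independent
sample does not change the distribution. -/
lemma measurePreserving_update_pi (ν : ∀ i, Measure (B i)) [∀ i, IsProbabilityMeasure (ν i)]
    (i : ι) :
    MeasurePreserving (fun p : (∀ i, B i) × (∀ i, B i) => Function.update p.1 i (p.2 i))
      ((Measure.pi ν).prod (Measure.pi ν)) (Measure.pi ν) := by
  have hm : Measurable (fun p : (∀ i, B i) × (∀ i, B i) => Function.update p.1 i (p.2 i)) := by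
    refine measurable_pi_iff.2 fun j => ?_
    by_cases hj : j = i
    · subst hj; simp only [Function.update_self]; fun_prop
    · simp only [Function.update_of_ne hj]; fun_prop
  refine ⟨hm, (Measure.pi_eq fun s hs => ?_).symm⟩
  rw [Measure.map_apply hm (MeasurableSet.univ_pi hs)]
  have : (fun p : (∀ i, B i) × (∀ i, B i) => Function.update p.1 i (p.2 i)) ⁻¹' Set.univ.pi s
      = (Set.univ.pi (Function.update s i Set.univ)) ×ˢ
        (Set.univ.pi (Function.update (fun _ => Set.univ) i (s i))) := by
    ext p
    simp only [Set.mem_preimage, Set.mem_univ_pi, Set.mem_prod]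
    constructor
    · intro h
      refine ⟨fun j => ?_, fun j => ?_⟩ <;> by_cases hj : j = i
      · subst hj; simp
      · simpa [hj] using h j
      · subst hj; simpa using h j
      · simp [hj]
    · rintro ⟨h1, h2⟩ j
      by_cases hj : j = i
      · subst hj; simpa using h2 j
      · simpa [hj] using h1 j
  rw [this, Measure.prod_prod, Measure.pi_pi, Measure.pi_pi, ← Finset.prod_mul_distrib]
  refine Finset.prod_congr rfl fun j _ => ?_
  by_cases hj : j = i
  · subst hj; simp
  · simp [hj]

variable {Ω : Type*} [MeasurableSpace Ω] {P : Measure Ω} [IsProbabilityMeasure P]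

/-- Fubini for independent coordinates `Z`: expectations may be computed by drawing coordinate `i`
from an independent copy. -/
lemma integral_resample {Z : Ω → ∀ i, B i} (hZ : Measurable Z)
    (hind : iIndepFun (fun i ω => Z ω i) P) (i : ι) {H : (∀ i, B i) → ℝ} (hH : Measurable H)
    (hint : Integrable (fun ω => H (Z ω)) P) :
    Integrable (fun ω' => ∫ ω, H (Function.update (Z ω) i (Z ω' i)) ∂P) P ∧
      ∫ ω', ∫ ω, H (Function.update (Z ω) i (Z ω' i)) ∂P ∂P = ∫ ω, H (Z ω) ∂P := by
  have hZi : ∀ j, Measurable fun ω => Z ω j := fun j => (measurable_pi_apply j).comp hZ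
  have hpi : P.map Z = Measure.pi fun j => P.map fun ω => Z ω j :=
    (iIndepFun_iff_map_fun_eq_pi_map fun j => (hZi j).aemeasurable).1 hind
  have : ∀ j, IsProbabilityMeasure (P.map fun ω => Z ω j) := fun j =>
    Measure.isProbabilityMeasure_map (hZi j).aemeasurable
  have hZP : MeasurePreserving Z P (Measure.pi fun j => P.map fun ω => Z ω j) := ⟨hZ, hpi⟩
  have hmp := (measurePreserving_update_pi (fun j => P.map fun ω => Z ω j) i).comp (hZP.prod hZP)
  have hint' : Integrable H (Measure.pi fun j => P.map fun ω => Z ω j) :=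
    (hZP.integrable_comp hH.aestronglyMeasurable).1 hint
  have h2 : Integrable (fun p : Ω × Ω => H (Function.update (Z p.1) i (Z p.2 i))) (P.prod P) :=
    (hmp.integrable_comp hH.aestronglyMeasurable).2 hint'
  refine ⟨h2.integral_prod_right, ?_⟩
  rw [← integral_prod_symm _ h2]
  have e1 : ∫ p, H (Function.update (Z p.1) i (Z p.2 i)) ∂(P.prod P)
      = ∫ z, H z ∂(Measure.pi fun j => P.map fun ω => Z ω j) := by
    rw [← hmp.map_eq, integral_map hmp.measurable.aemeasurable hH.aestronglyMeasurable]
    rfl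
  rw [e1, ← hpi, integral_map hZ.aemeasurable hH.aestronglyMeasurable]

end Resample

/-! ### Interim outcomes of a mechanism -/

lemma Environment.mem_Icc_of_mem_convexHull {ι : Type*} [DecidableEq ι] (X : Environment ι)
    {x : ι → ℝ} (hx : x ∈ convexHull ℝ X.feasible) (i : ι) : x i ∈ Set.Icc (0 : ℝ) 1 := by
  have hconv : Convex ℝ {x : ι → ℝ | x i ∈ Set.Icc (0 : ℝ) 1} :=
    (convex_Icc (0 : ℝ) 1).linear_preimage (LinearMap.proj i : (ι → ℝ) →ₗ[ℝ] ℝ)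
  exact convexHull_min (fun y hy => X.mem_unit y hy i) hconv hx

lemma integrable_mul_bdd_value {ι : Type*} {A : ι → Type*} [∀ i, MeasurableSpace (A i)]
    {G : Measure ((ι → ℝ) × (∀ i, A i))} {k : ((ι → ℝ) × (∀ i, A i)) → ℝ} {i : ι}
    (hV : Integrable (fun ω => ω.1 i) G) (hk : Measurable k) (k0 : ∀ ω, 0 ≤ k ω)
    (k1 : ∀ ω, k ω ≤ 1) : Integrable (fun ω => ω.1 i * k ω) G :=
  hV.mul_bdd (c := 1) hk.aestronglyMeasurable (Filter.Eventually.of_forall fun ω => by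
    simpa [abs_of_nonneg (k0 ω)] using k1 ω)

/-- The σ-algebra generated by the value of agent `i`. -/
abbrev valueAlgebra {ι : Type*} (A : ι → Type*) [∀ i, MeasurableSpace (A i)] (i : ι) :
    MeasurableSpace ((ι → ℝ) × (∀ i, A i)) :=
  MeasurableSpace.comap (fun ω => ω.1 i) inferInstance

lemma valueAlgebra_le {ι : Type*} {A : ι → Type*} [∀ i, MeasurableSpace (A i)] (i : ι) :
    valueAlgebra A i ≤ Prod.instMeasurableSpace :=
  ((measurable_pi_apply i).comp measurable_fst).comap_le

namespace Mechanism

variable {ι : Type*} [DecidableEq ι] {A : ι → Type*} [∀ i, MeasurableSpace (A i)]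
  {X : Environment ι} {M : Mechanism A X} {G : Measure ((ι → ℝ) × (∀ i, A i))}

lemma alloc_nonneg (M : Mechanism A X) (a : ∀ i, A i) (i : ι) : 0 ≤ M.alloc a i :=
  (X.mem_Icc_of_mem_convexHull (M.alloc_mem a) i).1

lemma alloc_le_one (M : Mechanism A X) (a : ∀ i, A i) (i : ι) : M.alloc a i ≤ 1 :=
  (X.mem_Icc_of_mem_convexHull (M.alloc_mem a) i).2

lemma integrable_alloc [IsProbabilityMeasure G] (i : ι)
    {k : ((ι → ℝ) × (∀ i, A i)) → ∀ i, A i} (hk : Measurable k) :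
    Integrable (fun ω => M.alloc (k ω) i) G := by
  refine (integrable_const (1 : ℝ)).mono' ((M.measurable_alloc i).comp hk).aestronglyMeasurable ?_
  exact Filter.Eventually.of_forall fun ω => by
    simpa [abs_of_nonneg (M.alloc_nonneg _ i)] using M.alloc_le_one _ i

lemma measurable_update_const (i : ι) (a : A i) :
    Measurable fun ω : (ι → ℝ) × (∀ i, A i) => Function.update ω.2 i a :=
  (measurable_update_left (a := i) (x := a)).comp measurable_snd

lemma measurable_update_prod (i : ι) :
    Measurable fun p : ((ι → ℝ) × (∀ i, A i)) × A i => Function.update p.1.2 i p.2 := by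
  refine measurable_pi_iff.2 fun j => ?_
  by_cases hj : j = i
  · subst hj; simp only [Function.update_self]; fun_prop
  · simp only [Function.update_of_ne hj]; fun_prop

lemma interimAlloc_nonneg (i : ι) (a : A i) : 0 ≤ M.interimAlloc G i a :=
  integral_nonneg fun _ => M.alloc_nonneg _ i

lemma interimAlloc_le_one [IsProbabilityMeasure G] (i : ι) (a : A i) :
    M.interimAlloc G i a ≤ 1 := by
  have := integral_mono (integrable_alloc (M := M) (G := G) i (measurable_update_const i a))
    (integrable_const (1 : ℝ)) fun ω => M.alloc_le_one _ i
  rw [integral_const, probReal_univ, one_smul] at this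
  exact this

lemma measurable_interimAlloc [IsProbabilityMeasure G] (i : ι) :
    Measurable (M.interimAlloc G i) :=
  (StronglyMeasurable.integral_prod_left (μ := G)
    (f := fun ω a => M.alloc (Function.update ω.2 i a) i)
    ((M.measurable_alloc i).comp (measurable_update_prod i)).stronglyMeasurable).measurable

variable (M G) in
/-- Interim utility of agent `i` with value `v` from the action `a`. -/
noncomputable def interimUtility (i : ι) (v : ℝ) (a : A i) : ℝ :=
  v * M.interimAlloc G i a - M.interimPay G i a

lemma measurable_utility (M : Mechanism A X) (i : ι) :
    Measurable (Function.uncurry fun (v : ℝ) (a : ∀ i, A i) => M.utility i v a) :=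
  (measurable_fst.mul ((M.measurable_alloc i).comp measurable_snd)).sub
    ((M.measurable_pay i).comp measurable_snd)

lemma integral_utility_update (hG : M.IsIndependentOutcome G) (i : ι) (v : ℝ) (a : A i) :
    ∫ ω, M.utility i v (Function.update ω.2 i a) ∂G = M.interimUtility G i v a := by
  have := hG.isProbabilityMeasure
  simp only [utility]
  rw [integral_sub ((integrable_alloc i (measurable_update_const i a)).const_mul v)
    (hG.paymentsIntegrable.2 i a), integral_const_mul]
  rfl

lemma integrable_utility (hG : M.IsIndependentOutcome G) (i : ι)
    (hV : Integrable (fun ω => ω.1 i) G) :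
    Integrable (fun ω => M.utility i (ω.1 i) ω.2) G := by
  have := hG.isProbabilityMeasure
  exact (integrable_mul_bdd_value hV ((M.measurable_alloc i).comp measurable_snd)
    (fun _ => M.alloc_nonneg _ i) (fun _ => M.alloc_le_one _ i)).sub
    (hG.paymentsIntegrable.1 i)

lemma integrable_utility_update (hG : M.IsIndependentOutcome G) (i : ι)
    (hV : Integrable (fun ω => ω.1 i) G) (a : A i) :
    Integrable (fun ω => M.utility i (ω.1 i) (Function.update ω.2 i a)) G := by
  have := hG.isProbabilityMeasure
  exact (integrable_mul_bdd_value hV ((M.measurable_alloc i).comp (measurable_update_const i a))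
    (fun _ => M.alloc_nonneg _ i) (fun _ => M.alloc_le_one _ i)).sub
    (hG.paymentsIntegrable.2 i a)

variable [Fintype ι]

/-- Without bidder communication, expectations may be computed by drawing the value and the action
of agent `i` from an independent copy. -/
lemma integral_resample_agent (hG : M.IsIndependentOutcome G) (i : ι)
    {H : ℝ → (∀ i, A i) → ℝ} (hH : Measurable (Function.uncurry H))
    (hint : Integrable (fun ω => H (ω.1 i) ω.2) G) :
    Integrable (fun ω' => ∫ ω, H (ω'.1 i) (Function.update ω.2 i (ω'.2 i)) ∂G) G ∧
      ∫ ω', ∫ ω, H (ω'.1 i) (Function.update ω.2 i (ω'.2 i)) ∂G ∂G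
        = ∫ ω, H (ω.1 i) ω.2 ∂G := by
  have := hG.isProbabilityMeasure
  have hZ : Measurable fun (ω : (ι → ℝ) × (∀ i, A i)) (j : ι) => (ω.1 j, ω.2 j) := by fun_prop
  have hH' : Measurable fun z : ∀ j, ℝ × A j => H (z i).1 fun j => (z j).2 :=
    hH.comp (f := fun z : ∀ j, ℝ × A j => ((z i).1, fun j => (z j).2)) (by fun_prop)
  have key := integral_resample hZ hG.noBidderCommunication i hH' hint
  have e : ∀ ω ω' : (ι → ℝ) × (∀ i, A i),
      (fun j => (Function.update (fun j => (ω.1 j, ω.2 j)) i (ω'.1 i, ω'.2 i) j).2)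
        = Function.update ω.2 i (ω'.2 i) := by
    intro ω ω'
    ext j
    by_cases hj : j = i
    · subst hj; simp
    · simp [hj]
  simpa only [e, Function.update_self] using key

lemma integrable_interimPay (hG : M.IsIndependentOutcome G) (i : ι) :
    Integrable (fun ω => M.interimPay G i (ω.2 i)) G :=
  (integral_resample_agent hG i (H := fun _ a => M.pay a i)
    ((M.measurable_pay i).comp measurable_snd) (hG.paymentsIntegrable.1 i)).1

lemma integral_interimPay (hG : M.IsIndependentOutcome G) (i : ι) :
    ∫ ω, M.interimPay G i (ω.2 i) ∂G = ∫ ω, M.pay ω.2 i ∂G :=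
  (integral_resample_agent hG i (H := fun _ a => M.pay a i)
    ((M.measurable_pay i).comp measurable_snd) (hG.paymentsIntegrable.1 i)).2

lemma integrable_interimUtility (hG : M.IsIndependentOutcome G) (i : ι)
    (hV : Integrable (fun ω => ω.1 i) G) :
    Integrable (fun ω => M.interimUtility G i (ω.1 i) (ω.2 i)) G := by
  have := hG.isProbabilityMeasure
  exact (integrable_mul_bdd_value hV ((measurable_interimAlloc i).comp (by fun_prop))
    (fun _ => interimAlloc_nonneg i _) (fun _ => interimAlloc_le_one i _)).sub
    (integrable_interimPay hG i)

/-- On events of the own value, realized and interim utility have the same expectation. -/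
lemma setIntegral_utility (hG : M.IsIndependentOutcome G) (i : ι)
    (hV : Integrable (fun ω => ω.1 i) G) {s : Set ℝ} (hs : MeasurableSet s) :
    ∫ ω in (fun ω => ω.1 i) ⁻¹' s, M.utility i (ω.1 i) ω.2 ∂G
      = ∫ ω in (fun ω => ω.1 i) ⁻¹' s, M.interimUtility G i (ω.1 i) (ω.2 i) ∂G := by
  have hs' : MeasurableSet ((fun ω : (ι → ℝ) × (∀ i, A i) => ω.1 i) ⁻¹' s) :=
    hs.preimage (by fun_prop)
  have key := (integral_resample_agent hG i
    (H := fun v a => s.indicator (fun v => M.utility i v a) v)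
    (Measurable.indicator (s := Prod.fst ⁻¹' s) (M.measurable_utility i)
      (hs.preimage measurable_fst))
    ((integrable_utility hG i hV).indicator hs')).2
  rw [← integral_indicator hs', ← integral_indicator hs']
  refine Eq.trans key.symm ?_
  refine integral_congr_ae (Filter.Eventually.of_forall fun ω' => ?_)
  by_cases h : ω'.1 i ∈ s
  · simp [Set.indicator, h, integral_utility_update hG]
  · simp [Set.indicator, h]

lemma setIntegral_utility_update (hG : M.IsIndependentOutcome G) (i : ι)
    (hV : Integrable (fun ω => ω.1 i) G) (a : A i) {s : Set ℝ} (hs : MeasurableSet s) :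
    ∫ ω in (fun ω => ω.1 i) ⁻¹' s, M.utility i (ω.1 i) (Function.update ω.2 i a) ∂G
      = ∫ ω in (fun ω => ω.1 i) ⁻¹' s, M.interimUtility G i (ω.1 i) a ∂G := by
  have hs' : MeasurableSet ((fun ω : (ι → ℝ) × (∀ i, A i) => ω.1 i) ⁻¹' s) :=
    hs.preimage (by fun_prop)
  have hm : Measurable fun p : ℝ × (∀ i, A i) => (p.1, Function.update p.2 i a) :=
    measurable_fst.prodMk (measurable_update_left.comp measurable_snd)
  have key := (integral_resample_agent hG i
    (H := fun v b => s.indicator (fun v => M.utility i v (Function.update b i a)) v)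
    (Measurable.indicator (s := Prod.fst ⁻¹' s) ((M.measurable_utility i).comp hm)
      (hs.preimage measurable_fst))
    ((integrable_utility_update hG i hV a).indicator hs')).2
  rw [← integral_indicator hs', ← integral_indicator hs']
  refine Eq.trans key.symm ?_
  refine integral_congr_ae (Filter.Eventually.of_forall fun ω' => ?_)
  by_cases h : ω'.1 i ∈ s
  · simp [Set.indicator, h, integral_utility_update hG]
  · simp [Set.indicator, h]

lemma condExp_utility (hG : M.IsIndependentOutcome G) (i : ι)
    (hV : Integrable (fun ω => ω.1 i) G) :
    condExp (valueAlgebra A i) G (fun ω => M.interimUtility G i (ω.1 i) (ω.2 i))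
      =ᵐ[G] condExp (valueAlgebra A i) G (fun ω => M.utility i (ω.1 i) ω.2) := by
  have := hG.isProbabilityMeasure
  refine ae_eq_condExp_of_forall_setIntegral_eq (valueAlgebra_le i) (integrable_utility hG i hV)
    (fun _ _ _ => integrable_condExp.integrableOn) ?_
    stronglyMeasurable_condExp.aestronglyMeasurable
  intro t ht _
  rw [setIntegral_condExp (valueAlgebra_le i) (integrable_interimUtility hG i hV) ht]
  obtain ⟨s, hs, rfl⟩ := ht
  exact (setIntegral_utility hG i hV hs).symm

lemma condExp_utility_update (hG : M.IsIndependentOutcome G) (i : ι)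
    (hV : Integrable (fun ω => ω.1 i) G) (a : A i) :
    (fun ω => M.interimUtility G i (ω.1 i) a)
      =ᵐ[G] condExp (valueAlgebra A i) G
        (fun ω => M.utility i (ω.1 i) (Function.update ω.2 i a)) := by
  have := hG.isProbabilityMeasure
  have hint : Integrable (fun ω => M.interimUtility G i (ω.1 i) a) G :=
    (hV.mul_const _).sub (integrable_const _)
  refine ae_eq_condExp_of_forall_setIntegral_eq (valueAlgebra_le i)
    (integrable_utility_update hG i hV a) (fun _ _ _ => hint.integrableOn) ?_ ?_
  · rintro _ ⟨s, hs, rfl⟩ _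
    exact (setIntegral_utility_update hG i hV a hs).symm
  · have h1 : Measurable[valueAlgebra A i] fun ω : (ι → ℝ) × (∀ i, A i) => ω.1 i :=
      comap_measurable _
    exact ((h1.mul_const _).sub_const _).stronglyMeasurable.aestronglyMeasurable

/-- Best response in interim form: almost surely no action is better than the one played. The
conditional expectation of the utility given the value dominates every single action, hence the
supremum over all actions, and that supremum in turn dominates the utility of the action played;
so all three agree. -/
lemma ae_forall_interimUtility_le (hG : M.IsIndependentOutcome G) (hbr : M.SatisfiesBestResponse G)
    (i : ι) (hV : Integrable (fun ω => ω.1 i) G) :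
    ∀ᵐ ω ∂G, ∀ a, M.interimUtility G i (ω.1 i) a ≤ M.interimUtility G i (ω.1 i) (ω.2 i) := by
  have := hG.isProbabilityMeasure
  set κ := condExp (valueAlgebra A i) G (fun ω => M.interimUtility G i (ω.1 i) (ω.2 i)) with hκ
  have h1 : ∀ a : A i, ∀ᵐ ω ∂G, M.interimUtility G i (ω.1 i) a ≤ κ ω := by
    intro a
    filter_upwards [condExp_utility hG i hV, condExp_utility_update hG i hV a, hbr i a]
      with ω e1 e2 hle
    rw [hκ, e1, e2]
    exact hle
  have h2 : ∀ᵐ ω ∂G, ∀ a ∈ (Set.univ : Set (A i)),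
      ω.1 i * M.interimAlloc G i a - M.interimPay G i a ≤ κ ω :=
    ae_forall_menu_le fun a _ => h1 a
  obtain ⟨ω₀, hω₀⟩ := h2.exists
  have : Nonempty (A i) := ⟨ω₀.2 i⟩
  set h := menuUtility Set.univ (M.interimAlloc G i) (M.interimPay G i) with hh
  have hI : IsIndirectUtility h := isIndirectUtility_menuUtility Set.univ_nonempty
    (interimAlloc_nonneg i) (interimAlloc_le_one i) hω₀
  have hle : ∀ v a, M.interimUtility G i v a ≤ h v := fun v a =>
    le_ciSup (bddAbove_menu (interimAlloc_nonneg i) (interimAlloc_le_one i) hω₀ v)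
      ⟨a, Set.mem_univ a⟩
  have hK := integrable_interimUtility hG i hV
  have h3 : ∀ᵐ ω ∂G, h (ω.1 i) ≤ κ ω := by
    filter_upwards [h2] with ω hω using ciSup_le fun a => hω a a.2
  have hint : Integrable (fun ω : (ι → ℝ) × (∀ i, A i) => h (ω.1 i)) G := by
    refine integrable_of_le_of_le (hI.lipschitz.continuous.measurable.comp
      (by fun_prop)).aestronglyMeasurable
      (Filter.Eventually.of_forall fun ω => hle (ω.1 i) (ω.2 i)) h3 hK integrable_condExp
  have h4 : ∫ ω, M.interimUtility G i (ω.1 i) (ω.2 i) ∂G = ∫ ω, h (ω.1 i) ∂G := by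
    refine le_antisymm (integral_mono hK hint fun ω => hle _ _) ?_
    refine (integral_mono_ae hint integrable_condExp h3).trans_eq ?_
    exact integral_condExp (valueAlgebra_le i)
  have h5 := (integral_eq_iff_of_ae_le hK hint
    (Filter.Eventually.of_forall fun ω => hle _ _)).1 h4
  filter_upwards [h5] with ω hω a
  exact (hle _ a).trans hω.ge

end Mechanism

/-! ### Revenue of direct mechanisms -/

namespace DirectMechanism

variable {ι : Type*} [Fintype ι] [DecidableEq ι] {X : Environment ι} {F : Measure (ι → ℝ)}

/-- The payments of an incentive compatible and individually rational direct mechanism are at most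
the positive part of its virtual surplus. -/
lemma integral_pay_le [IsProbabilityMeasure F]
    (hind : iIndepFun (fun i (v : ι → ℝ) => v i) F) (D : DirectMechanism X)
    (hD : ∀ i, Integrable (fun v => D.pay v i) F) (hbic : D.IsBIC F) (hir : D.IsIR F) (i : ι)
    {I : Set ℝ} {f : ℝ → ℝ} (hreg : IsRegularWith (F.map fun u => u i) I f)
    (hmean : Integrable (fun v => v i) F) :
    ∫ v, D.pay v i ∂F
      ≤ ∫ v, max (virtualValue (F.map fun u => u i) f (v i)) 0 * D.alloc v i ∂F := by
  have hev : Measurable fun u : ι → ℝ => u i := measurable_pi_apply i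
  set Fi := F.map fun u => u i with hFi
  have : IsProbabilityMeasure Fi := Measure.isProbabilityMeasure_map hev.aemeasurable
  have hmean' : Integrable (fun v => v) Fi :=
    (integrable_map_measure measurable_id.aestronglyMeasurable hev.aemeasurable).2 hmean
  set g : ℝ → ℝ := fun w => ∫ u, D.alloc (Function.update u i w) i ∂F with hg
  set q : ℝ → ℝ := fun w => ∫ u, D.pay (Function.update u i w) i ∂F with hq
  have a0 : ∀ v, 0 ≤ D.alloc v i := fun v => (X.mem_Icc_of_mem_convexHull (D.alloc_mem v) i).1
  have a1 : ∀ v, D.alloc v i ≤ 1 := fun v => (X.mem_Icc_of_mem_convexHull (D.alloc_mem v) i).2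
  have g0 : ∀ w, 0 ≤ g w := fun w => integral_nonneg fun _ => a0 _
  have g1 : ∀ w, g w ≤ 1 := fun w => by
    have h1 : Integrable (fun u => D.alloc (Function.update u i w) i) F := by
      refine (integrable_const (1 : ℝ)).mono'
        ((D.measurable_alloc i).comp measurable_update_left).aestronglyMeasurable ?_
      exact Filter.Eventually.of_forall fun u => by simpa [abs_of_nonneg (a0 _)] using a1 _
    have := integral_mono h1 (integrable_const (1 : ℝ)) fun u => a1 _
    rw [integral_const, probReal_univ, one_smul] at this
    exact this
  have hup : Measurable fun p : (ι → ℝ) × ℝ => Function.update p.1 i p.2 := by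
    refine measurable_pi_iff.2 fun j => ?_
    by_cases hj : j = i
    · subst hj; simp only [Function.update_self]; fun_prop
    · simp only [Function.update_of_ne hj]; fun_prop
  have gm : Measurable g := (StronglyMeasurable.integral_prod_left (μ := F)
    (f := fun u w => D.alloc (Function.update u i w) i)
    ((D.measurable_alloc i).comp hup).stronglyMeasurable).measurable
  have qm : Measurable q := (StronglyMeasurable.integral_prod_left (μ := F)
    (f := fun u w => D.pay (Function.update u i w) i)
    ((D.measurable_pay i).comp hup).stronglyMeasurable).measurable
  have hpay := (integral_resample measurable_id hind i (D.measurable_pay i) (hD i)).2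
  -- Incentive compatibility holds only almost everywhere, so the menu is restricted to the
  -- reports that almost no type prefers to the truth. Almost every report is of this kind.
  set S : Set ℝ := {w | ∀ᵐ v ∂Fi, v * g w - q w ≤ v * g v - q v} with hS
  have hmS : MeasurableSet {p : ℝ × ℝ | p.1 * g p.2 - q p.2 ≤ p.1 * g p.1 - q p.1} :=
    measurableSet_le (by fun_prop) (by fun_prop)
  have hαS : ∀ᵐ w ∂Fi, w ∈ S := (Measure.ae_ae_comm hmS).1 (hbic i)
  obtain ⟨hI, -, hae⟩ := ae_envelope (S := S) (q := q) (P := Fi) (V := fun v => v)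
    (α := fun v => v) measurable_id
    (by rw [Measure.map_id']; exact hreg.absolutelyContinuous) g0 g1 hαS
    (ae_forall_menu_le fun w hw => hw)
  have hpos : ∀ᵐ v ∂Fi, 0 ≤ menuUtility S g q v := by
    filter_upwards [hae, hir i] with v hv h0
    rw [hv.1]
    exact h0
  have key := hI.integral_payment_le hreg hmean' hpos
  have e1 : ∫ v, (v * deriv (menuUtility S g q) v - menuUtility S g q v) ∂Fi
      = ∫ v, D.pay v i ∂F := by
    refine Eq.trans ?_ hpay
    rw [show ∫ v, (v * deriv (menuUtility S g q) v - menuUtility S g q v) ∂Fi = ∫ v, q v ∂Fi from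
      integral_congr_ae (by filter_upwards [hae] with v hv; rw [hv.1, hv.2]; ring)]
    rw [hFi, integral_map hev.aemeasurable qm.aestronglyMeasurable]
    rfl
  have hφm : Measurable fun v => max (virtualValue Fi f v) 0 :=
    hreg.measurable_virtualValue.max measurable_const
  have hφ : Integrable (fun v => max (virtualValue Fi f v) 0) Fi :=
    (hreg.integrable_virtualValue hmean').pos_part
  have e2 : ∫ v, max (virtualValue Fi f v) 0 * deriv (menuUtility S g q) v ∂Fi
      = ∫ v, max (virtualValue Fi f (v i)) 0 * D.alloc v i ∂F := by
    have hint : Integrable (fun v => max (virtualValue Fi f (v i)) 0 * D.alloc v i) F := by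
      refine Integrable.mul_bdd (c := 1) (hφ.comp_measurable hev)
        (D.measurable_alloc i).aestronglyMeasurable ?_
      exact Filter.Eventually.of_forall fun u => by simpa [abs_of_nonneg (a0 _)] using a1 _
    have h2 := (integral_resample measurable_id hind i
      (H := fun v => max (virtualValue Fi f (v i)) 0 * D.alloc v i)
      ((hφm.comp hev).mul (D.measurable_alloc i)) hint).2
    refine Eq.trans ?_ h2
    rw [show ∫ v, max (virtualValue Fi f v) 0 * deriv (menuUtility S g q) v ∂Fi
        = ∫ v, max (virtualValue Fi f v) 0 * g v ∂Fi from
      integral_congr_ae (by filter_upwards [hae] with v hv; rw [hv.2])]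
    have h3 := integral_map (μ := F) hev.aemeasurable
      (f := fun v => max (virtualValue Fi f v) 0 * g v) (hφm.mul gm).aestronglyMeasurable
    refine h3.trans ?_
    simp only [Function.update_self, id]
    refine integral_congr_ae (Filter.Eventually.of_forall fun w => ?_)
    simp only
    rw [integral_const_mul]
  rw [e1, e2] at key
  exact key

end DirectMechanism

/-! ### Covering the virtual value of an agent -/

lemma neg_exp_inv_le_mul_log {x : ℝ} (hx : 0 ≤ x) : -(Real.exp 1)⁻¹ ≤ x * Real.log x := by
  rcases hx.eq_or_lt with rfl | hx
  · simp [(Real.exp_pos 1).le]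
  have he := Real.exp_pos 1
  have h1 := Real.log_le_sub_one_of_pos (x := (Real.exp 1 * x)⁻¹) (by positivity)
  rw [Real.log_inv, Real.log_mul he.ne' hx.ne', Real.log_exp] at h1
  have h2 : x * (Real.exp 1 * x)⁻¹ = (Real.exp 1)⁻¹ := by field_simp
  nlinarith [mul_le_mul_of_nonneg_left h1 hx.le]

/-- The threshold surplus when every threshold exceeds the hyperbola `v - k / z` of prices at which
an agent with value `v` would not gain more than `k`, and thresholds are counted where the hyperbola
is above `r`. -/
lemma ofReal_le_lintegral_threshold {v r k : ℝ} {D : ℝ → ℝ≥0∞} (hr : 0 ≤ r) (hrv : r < v)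
    (hk : 0 ≤ k) (hkv : k ≤ v - r)
    (hD : ∀ z ∈ Set.Ioc (0 : ℝ) 1, r < v - k / z → ENNReal.ofReal (v - k / z) ≤ D z) :
    ENNReal.ofReal (v * (1 - k / (v - r)) + k * Real.log (k / (v - r)))
      ≤ ∫⁻ z in Set.Ioc 0 1, D z := by
  have hvr : 0 < v - r := sub_pos.2 hrv
  set c := k / (v - r) with hc
  have hc0 : 0 ≤ c := div_nonneg hk hvr.le
  have hc1 : c ≤ 1 := (div_le_one hvr).2 hkv
  have hz : ∀ z ∈ Set.Ioc c 1, r < v - k / z := by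
    intro z hz
    have hz0 : 0 < z := hc0.trans_lt hz.1
    have h1 : k < z * (v - r) := by
      have := hz.1; rw [hc, div_lt_iff₀ hvr] at this; exact this
    have : k / z < v - r := by rw [div_lt_iff₀ hz0]; linarith
    linarith
  have hint : IntervalIntegrable (fun z => v - k / z) volume c 1 ∧
      ∫ z in c..1, (v - k / z) = v * (1 - c) + k * Real.log c := by
    rcases hk.eq_or_lt with hk0 | hk0
    · have hcz : c = 0 := by rw [hc, ← hk0, zero_div]
      simp [← hk0, hcz]
    · have hcp : 0 < c := div_pos hk0 hvr
      have h0 : (0 : ℝ) ∉ Set.uIcc c 1 := by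
        rw [Set.uIcc_of_le hc1]; exact fun h => absurd h.1 (not_le.2 hcp)
      have h1 : IntervalIntegrable (fun z : ℝ => k / z) volume c 1 := by
        simp only [div_eq_mul_inv]
        exact (intervalIntegral.intervalIntegrable_inv (fun x hx => fun h => h0 (h ▸ hx))
          continuousOn_id).const_mul k
      refine ⟨intervalIntegrable_const.sub h1, ?_⟩
      rw [intervalIntegral.integral_sub intervalIntegrable_const h1]
      simp only [div_eq_mul_inv, intervalIntegral.integral_const_mul, integral_inv h0,
        intervalIntegral.integral_const, smul_eq_mul, one_mul, Real.log_inv]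
      ring
  rw [← hint.2, intervalIntegral.integral_of_le hc1, ofReal_integral_eq_lintegral_ofReal]
  · refine (setLIntegral_mono_ae' measurableSet_Ioc
      (Filter.Eventually.of_forall fun z hzc => ?_)).trans
      (lintegral_mono_set (Set.Ioc_subset_Ioc_left hc0))
    exact hD z ⟨hc0.trans_lt hzc.1, hzc.2⟩ (hz z hzc)
  · exact (intervalIntegrable_iff_integrableOn_Ioc_of_le hc1).1 hint.1
  · filter_upwards [ae_restrict_mem measurableSet_Ioc] with z hzc
    exact hr.trans (hz z hzc).le

/-- Virtual value covering: an agent with value `v` and virtual value `φ ≤ v`, who gets utility at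
most `(v - r) x` from the allocation `x`, either is served with a large probability or faces high
thresholds. With `c = u⁺ / (v - r) ≤ x` the thresholds contribute at least
`v (1 - c + c log c) ≥ φ (1 - c + c log c)`, and `c log c ≥ -1/e`. -/
lemma virtualValue_covering {v r u x φ : ℝ} {D : ℝ → ℝ≥0∞} (hr : 0 ≤ r) (hrv : r < v)
    (hφ : 0 ≤ φ) (hφv : φ ≤ v) (hx0 : 0 ≤ x) (hx1 : x ≤ 1) (hu : u ≤ (v - r) * x)
    (hD : ∀ z ∈ Set.Ioc (0 : ℝ) 1, r < v - max u 0 / z →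
      ENNReal.ofReal (v - max u 0 / z) ≤ D z)
    (hfin : ∫⁻ z in Set.Ioc 0 1, D z ≠ ∞) :
    (1 - (Real.exp 1)⁻¹) * φ ≤ φ * x + (∫⁻ z in Set.Ioc 0 1, D z).toReal := by
  have hvr : 0 < v - r := sub_pos.2 hrv
  have hkx : max u 0 ≤ (v - r) * x := max_le hu (mul_nonneg hvr.le hx0)
  have hkv : max u 0 ≤ v - r := hkx.trans (mul_le_of_le_one_right hvr.le hx1)
  have h1 := ofReal_le_lintegral_threshold hr hrv (le_max_right u 0) hkv hD
  have h2 := (ENNReal.ofReal_le_iff_le_toReal hfin).1 h1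
  set c := max u 0 / (v - r) with hc
  have hk : max u 0 = c * (v - r) := by rw [hc]; field_simp
  have hc0 : 0 ≤ c := div_nonneg (le_max_right _ _) hvr.le
  have hcx : c ≤ x := by rw [hc, div_le_iff₀ hvr]; linarith
  have hlog : Real.log c ≤ 0 := Real.log_nonpos hc0 (hcx.trans hx1)
  have hlc := neg_exp_inv_le_mul_log hc0
  -- `1 - c + c log c ≥ 0`, from `log c⁻¹ ≤ c⁻¹ - 1`.
  have h3 : 0 ≤ 1 - c + c * Real.log c := by
    rcases hc0.eq_or_lt with h | h
    · simp [← h]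
    · have := Real.log_le_sub_one_of_pos (inv_pos.2 h)
      rw [Real.log_inv] at this
      have h4 : c * c⁻¹ = 1 := mul_inv_cancel₀ h.ne'
      nlinarith [mul_le_mul_of_nonneg_left this h.le]
  have h5 : v * (c * Real.log c) ≤ max u 0 * Real.log c := by
    rw [hk]
    nlinarith [mul_nonpos_of_nonneg_of_nonpos (mul_nonneg hc0 hr) hlog]
  have h6 := mul_le_mul_of_nonneg_right hφv h3
  have h7 := mul_le_mul_of_nonneg_left hcx hφ
  have h8 := mul_le_mul_of_nonneg_left hlc hφ
  linarith

namespace Mechanism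

variable {ι : Type*} [DecidableEq ι] {A : ι → Type*} [∀ i, MeasurableSpace (A i)]
  {X : Environment ι} {M : Mechanism A X} {G : Measure ((ι → ℝ) × (∀ i, A i))}

lemma mul_interimAlloc_le_interimPay {i : ι} {a : A i} {r : ℝ}
    (h : (r : EReal) ≤ M.pricePerUnit G i a) :
    r * M.interimAlloc G i a ≤ M.interimPay G i a := by
  unfold pricePerUnit at h
  split_ifs at h with h1 h2
  · exact absurd h (by simp)
  · rw [h1, mul_zero]; exact not_lt.1 h2
  · have hpos : 0 < M.interimAlloc G i a := lt_of_le_of_ne (interimAlloc_nonneg i a) (Ne.symm h1)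
    rw [EReal.coe_le_coe_iff, le_div_iff₀ hpos] at h
    exact h

/-- If no action gives value `v` more utility than `u`, then an allocation of at least `z` costs at
least `v - u⁺ / z` per unit. -/
lemma le_thresholdCost {i : ι} {v u z : ℝ} (hz : 0 < z)
    (hu : ∀ a, v * M.interimAlloc G i a - M.interimPay G i a ≤ u) :
    ((v - max u 0 / z : ℝ) : EReal) ≤ M.thresholdCost G i (M.pricePerUnit G i) z := by
  refine le_iInf₂ fun a ha => ?_
  have hpos : 0 < M.interimAlloc G i a := hz.trans_le ha
  rw [pricePerUnit, if_neg hpos.ne', EReal.coe_le_coe_iff, le_div_iff₀ hpos]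
  have h1 : max u 0 ≤ max u 0 / z * M.interimAlloc G i a := by
    rw [div_mul_eq_mul_div, le_div_iff₀ hz]
    exact mul_le_mul_of_nonneg_left ha (le_max_right _ _)
  have h2 := hu a
  have h3 := le_max_left u 0
  nlinarith

lemma ofReal_le_discountedThresholdCost {i : ι} {r : ℝ≥0} {v u z : ℝ} (hz : 0 < z)
    (hu : ∀ a, v * M.interimAlloc G i a - M.interimPay G i a ≤ u)
    (hr : (r : ℝ) < v - max u 0 / z) :
    ENNReal.ofReal (v - max u 0 / z)
      ≤ M.discountedThresholdCost G i (M.pricePerUnit G i) r z := by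
  have h1 := le_thresholdCost (M := M) (G := G) hz hu
  rw [discountedThresholdCost, if_pos ((EReal.coe_lt_coe_iff.2 hr).trans_le h1)]
  have h2 := EReal.toENNReal_le_toENNReal h1
  rwa [EReal.toENNReal_of_ne_top (EReal.coe_ne_top _), EReal.toReal_coe] at h2

end Mechanism

/-! ### Revenue of equilibria that respect reserves -/

variable {ι : Type*} [Fintype ι] [DecidableEq ι] {A : ι → Type*} [∀ i, MeasurableSpace (A i)]
  {X : Environment ι} {M : Mechanism A X} {G : Measure ((ι → ℝ) × (∀ i, A i))}

namespace Mechanism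

/-- In a best-response equilibrium that respects reserves, the payments of an agent are at least the
positive part of the agent's virtual surplus, and the threshold surplus of the agent makes up for
what the virtual surplus lacks of a `1 - 1/e` share of the virtual value. -/
lemma virtualSurplus_le_and_covering (hG : M.IsIndependentOutcome G)
    (hbr : M.SatisfiesBestResponse G) (i : ι) (hV : Integrable (fun ω => ω.1 i) G)
    {I : Set ℝ} {f : ℝ → ℝ} (hreg : IsRegularWith (G.map fun ω => ω.1 i) I f) {r : ι → ℝ≥0}
    (hr : IsMonopolyReserve (G.map fun ω => ω.1 i) (r i)) (hres : M.RespectsReserves G r) :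
    ∫ ω, max (virtualValue (G.map fun ω => ω.1 i) f (ω.1 i)) 0 * M.interimAlloc G i (ω.2 i) ∂G
        ≤ ∫ ω, M.pay ω.2 i ∂G ∧
      ∀ᵐ ω ∂G, M.thresholdSurplus G i (M.pricePerUnit G i) (r i) 1 ≠ ∞ →
        (1 - (Real.exp 1)⁻¹) * max (virtualValue (G.map fun ω => ω.1 i) f (ω.1 i)) 0
          ≤ max (virtualValue (G.map fun ω => ω.1 i) f (ω.1 i)) 0 * M.interimAlloc G i (ω.2 i)
            + (M.thresholdSurplus G i (M.pricePerUnit G i) (r i) 1).toReal := by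
  have := hG.isProbabilityMeasure
  have hev : Measurable fun ω : (ι → ℝ) × (∀ i, A i) => ω.1 i := by fun_prop
  set Fi := G.map fun ω => ω.1 i with hFi
  have : IsProbabilityMeasure Fi := Measure.isProbabilityMeasure_map hev.aemeasurable
  have hmean : Integrable (fun v => v) Fi :=
    (integrable_map_measure measurable_id.aestronglyMeasurable hev.aemeasurable).2 hV
  have hopt := ae_forall_interimUtility_le hG hbr i hV
  obtain ⟨hI, hle, hae⟩ := ae_envelope (S := Set.univ) (q := M.interimPay G i) (P := G)
    (V := fun ω => ω.1 i) (α := fun ω => ω.2 i) hev hreg.absolutelyContinuous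
    (interimAlloc_nonneg (G := G) i) (interimAlloc_le_one i) (by simp)
    (hopt.mono fun ω hω a _ => hω a)
  set h := menuUtility Set.univ (M.interimAlloc G i) (M.interimPay G i) with hh
  have hmono : Measurable h := hI.lipschitz.continuous.measurable
  have hge : ∀ᵐ ω ∂G, (r i : ℝ) ≤ ω.1 i → h (ω.1 i) ≤ (ω.1 i - r i) * deriv h (ω.1 i) := by
    filter_upwards [hae, hres i] with ω hω hR hrv
    have := mul_interimAlloc_le_interimPay (hR.1 hrv)
    rw [hω.1, hω.2]
    linarith
  have hlt : ∀ᵐ ω ∂G, ω.1 i < (r i : ℝ) → deriv h (ω.1 i) = 0 := by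
    filter_upwards [hae, hres i] with ω hω hR hrv
    rw [hω.2]
    exact hR.2 hrv
  have hge' : ∀ᵐ v ∂Fi, (r i : ℝ) ≤ v → h v ≤ (v - r i) * deriv h v := by
    refine (ae_map_iff hev.aemeasurable ?_).2 hge
    exact (measurableSet_le measurable_const measurable_id).imp
      (measurableSet_le hmono ((measurable_id.sub_const _).mul (measurable_deriv h)))
  have hlt' : ∀ᵐ v ∂Fi, v < (r i : ℝ) → deriv h v = 0 := by
    refine (ae_map_iff hev.aemeasurable ?_).2 hlt
    exact (measurableSet_lt measurable_id measurable_const).imp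
      (measurableSet_eq_fun (measurable_deriv h) measurable_const)
  constructor
  · have key := hI.le_integral_payment hreg hmean hr hge' hlt'
    have hφm : Measurable fun v => max (virtualValue Fi f v) 0 :=
      hreg.measurable_virtualValue.max measurable_const
    have e1 := integral_map (μ := G) hev.aemeasurable
      (f := fun v => max (virtualValue Fi f v) 0 * deriv h v)
      (hφm.mul (measurable_deriv h)).aestronglyMeasurable
    have e2 := integral_map (μ := G) hev.aemeasurable (f := fun v => v * deriv h v - h v)
      ((measurable_id.mul (measurable_deriv h)).sub hmono).aestronglyMeasurable
    rw [← hFi] at e1 e2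
    rw [e1, e2] at key
    rw [← integral_interimPay hG i]
    refine le_of_eq_of_le ?_ (key.trans_eq ?_)
    · exact integral_congr_ae (by filter_upwards [hae] with ω hω; rw [hω.2])
    · exact integral_congr_ae (by filter_upwards [hae] with ω hω; rw [hω.1, hω.2]; ring)
  · have hne : ∀ᵐ v ∂Fi, v ≠ (r i : ℝ) := by
      rw [ae_iff]; simpa using hreg.nullMeasure_singleton (r i)
    filter_upwards [hae, hge, ae_of_ae_map hev.aemeasurable hreg.ae_mem,
      ae_of_ae_map hev.aemeasurable hne] with ω hω hg hmem hner hfin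
    rcases lt_or_gt_of_ne hner with hlt | hgt
    · rw [max_eq_right (hreg.virtualValue_nonpos hmean hr hmem hlt)]
      simp
    · have hφ0 := hreg.virtualValue_nonneg hmean hr hmem hgt
      rw [max_eq_left hφ0]
      refine virtualValue_covering (u := h (ω.1 i)) (r i).2 hgt hφ0 ?_ (interimAlloc_nonneg i _)
        (interimAlloc_le_one i _) ?_ ?_ hfin
      · rw [virtualValue_eq]
        linarith [hreg.inverseHazard_nonneg hmem]
      · rw [← hω.2]
        exact hg hgt.le
      · intro z hz hrz
        exact ofReal_le_discountedThresholdCost hz.1 (fun a => hle _ a (Set.mem_univ a)) hrz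

lemma revenue_eq_sum (hG : M.IsIndependentOutcome G) :
    M.revenue G = ∑ i, ∫ ω, M.pay ω.2 i ∂G :=
  integral_finsetSum _ fun i _ => hG.paymentsIntegrable.1 i

end Mechanism

lemma Environment.zero_mem (X : Environment ι) : (0 : ι → ℝ) ∈ X.feasible := by
  obtain ⟨x, hx⟩ := X.nonempty
  have key : ∀ s : Finset ι, (fun j => if j ∈ s then 0 else x j) ∈ X.feasible := by
    intro s
    induction s using Finset.induction_on with
    | empty => simpa using hx
    | insert i s hi ih =>
      have := X.downwardClosed _ ih i
      convert this using 1
      ext j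
      by_cases hj : j = i
      · subst hj; simp
      · simp [hj]
  have h := key Finset.univ
  simp only [Finset.mem_univ, if_true] at h
  exact h

/-- Never allocating and never charging shows that the optimal revenue is nonnegative. -/
lemma optimalRevenue_nonneg (X : Environment ι) (F : Measure (ι → ℝ)) :
    0 ≤ optimalRevenue X F := by
  refine le_sSup ⟨⟨fun _ => 0, fun _ => 0, fun _ => measurable_const, fun _ => measurable_const,
    fun _ => subset_convexHull ℝ _ X.zero_mem⟩, ?_, ?_, ?_, ?_⟩
  · intro i; simp
  · intro i; simp [DirectMechanism.interimUtility]
  · intro i; simp [DirectMechanism.interimUtility]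
  · simp

lemma iIndepFun_values (hG : M.IsIndependentOutcome G) :
    iIndepFun (fun i (v : ι → ℝ) => v i) (G.map Prod.fst) := by
  have := hG.isProbabilityMeasure
  have h1 : iIndepFun (fun i (ω : (ι → ℝ) × (∀ i, A i)) => ω.1 i) G :=
    hG.noBidderCommunication.comp (fun i p => p.1) fun i => measurable_fst
  have : IsProbabilityMeasure (G.map Prod.fst) :=
    Measure.isProbabilityMeasure_map measurable_fst.aemeasurable
  rw [iIndepFun_iff_map_fun_eq_pi_map (fun i => by fun_prop)] at h1
  rw [iIndepFun_iff_map_fun_eq_pi_map (fun i => (measurable_pi_apply i).aemeasurable)]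
  simp only [Measure.map_map (measurable_pi_apply _) measurable_fst]
  rw [Measure.map_map (by fun_prop) measurable_fst]
  exact h1

end RobustAuction

open RobustAuction in
theorem mainTheorem3 {ι : Type*} [Fintype ι] [DecidableEq ι]
    {A : ι → Type*} [∀ i, MeasurableSpace (A i)]
    (X : RobustAuction.Environment ι) (hX : X.IsDeterministic)
    (M : RobustAuction.Mechanism A X)
    (G : MeasureTheory.Measure ((ι → ℝ) × (∀ i, A i)))
    (hG : M.IsIndependentOutcome G)
    (hmean : ∀ i, MeasureTheory.Integrable (fun ω => ω.1 i) G)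
    (hreg : ∀ i, RobustAuction.IsRegular (G.map fun ω => ω.1 i))
    (r : ι → NNReal)
    (hr : ∀ i, RobustAuction.IsMonopolyReserve (G.map fun ω => ω.1 i) (r i))
    (μ : ℝ) (hμ : μ ≤ 1)
    (hM : M.HasWeakCompetitiveEfficiency M.pricePerUnit r μ)
    (hbr : M.SatisfiesBestResponse G)
    (hres : M.RespectsReserves G r) :
    (((Real.exp 1 - 1) / (2 * Real.exp 1) * μ : ℝ) : EReal) *
        RobustAuction.optimalRevenue X (G.map Prod.fst)
      ≤ (M.revenue G : EReal) := by
  have := hG.isProbabilityMeasure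
  have he : 0 < Real.exp 1 := Real.exp_pos 1
  have he1 : 1 ≤ Real.exp 1 := Real.one_le_exp zero_le_one
  have hrev0 : 0 ≤ M.revenue G := by
    have h := hM G hG 0 X.zero_mem
    have h0 : ∑ i, M.thresholdSurplus G i (M.pricePerUnit G i) (r i) ((0 : ι → ℝ) i) = 0 := by
      simp [Mechanism.thresholdSurplus]
    rw [h0] at h
    simpa using h
  -- For `μ ≤ 0` the left side is nonpositive, and weak competitive efficiency at the zero
  -- allocation makes the revenue nonnegative.
  rcases le_or_gt μ 0 with hμ0 | hμ0
  · refine le_trans ?_ (EReal.coe_nonneg.2 hrev0)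
    refine EReal.mul_nonpos_iff.2 (Or.inr ⟨?_, optimalRevenue_nonneg _ _⟩)
    rw [EReal.coe_nonpos]
    exact mul_nonpos_of_nonneg_of_nonpos (div_nonneg (by linarith) (by linarith)) hμ0
  set c := (Real.exp 1 - 1) / (2 * Real.exp 1) * μ with hc
  have hc0 : 0 < c := mul_pos (div_pos (by linarith [Real.add_one_lt_exp one_ne_zero])
    (by linarith)) hμ0
  rw [mul_comm, ← EReal.le_div_iff_mul_le (EReal.coe_pos.2 hc0) (EReal.coe_ne_top _)]
  refine sSup_le ?_
  rintro _ ⟨D, hDint, hbic, hir, rfl⟩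
  rw [EReal.le_div_iff_mul_le (EReal.coe_pos.2 hc0) (EReal.coe_ne_top _), ← EReal.coe_mul,
    EReal.coe_le_coe_iff]
  choose I f h1 h2 h3 h4 h5 h6 using hreg
  have hregw : ∀ i, IsRegularWith (G.map fun ω => ω.1 i) (I i) (f i) := fun i =>
    ⟨h1 i, h2 i, h3 i, h4 i, h5 i, h6 i⟩
  have hmap : ∀ i, (G.map Prod.fst).map (fun u => u i) = G.map fun ω => ω.1 i := fun i =>
    Measure.map_map (measurable_pi_apply i) measurable_fst
  have : IsProbabilityMeasure (G.map Prod.fst) :=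
    Measure.isProbabilityMeasure_map measurable_fst.aemeasurable
  set φ : ι → ℝ → ℝ := fun i v => max (virtualValue (G.map fun ω => ω.1 i) (f i) v) 0 with hφ
  set T : ι → ℝ → ℝ≥0∞ := fun i => M.thresholdSurplus G i (M.pricePerUnit G i) (r i) with hT
  have hagent := fun i =>
    Mechanism.virtualSurplus_le_and_covering hG hbr i (hmean i) (hregw i) (hr i) hres
  have hevm : ∀ i, Measurable fun ω : (ι → ℝ) × (∀ i, A i) => ω.1 i := fun i => by fun_prop
  have hφi : ∀ i, Integrable (fun ω => φ i (ω.1 i)) G := by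
    intro i
    have : IsProbabilityMeasure (G.map fun ω => ω.1 i) :=
      Measure.isProbabilityMeasure_map (hevm i).aemeasurable
    exact ((hregw i).integrable_virtualValue ((integrable_map_measure
      measurable_id.aestronglyMeasurable (hevm i).aemeasurable).2 (hmean i))).pos_part
      |>.comp_measurable (hevm i)
  have hbdd : ∀ i (k : ((ι → ℝ) × (∀ i, A i)) → ℝ), Measurable k → (∀ ω, 0 ≤ k ω) →
      (∀ ω, k ω ≤ 1) → Integrable (fun ω => φ i (ω.1 i) * k ω) G := fun i k hk k0 k1 =>
    (hφi i).mul_bdd (c := 1) hk.aestronglyMeasurable (Filter.Eventually.of_forall fun ω => by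
      simpa [abs_of_nonneg (k0 ω)] using k1 ω)
  have hmech : ∀ i, Integrable (fun ω => φ i (ω.1 i) * M.interimAlloc G i (ω.2 i)) G := fun i =>
    hbdd i _ ((Mechanism.measurable_interimAlloc i).comp (by fun_prop))
      (fun _ => Mechanism.interimAlloc_nonneg i _) fun _ => Mechanism.interimAlloc_le_one i _
  have hdir : ∀ i, Integrable (fun ω => φ i (ω.1 i) * D.alloc ω.1 i) G := fun i =>
    hbdd i _ ((D.measurable_alloc i).comp measurable_fst)
      (fun ω => (X.mem_Icc_of_mem_convexHull (D.alloc_mem _) i).1)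
      fun ω => (X.mem_Icc_of_mem_convexHull (D.alloc_mem _) i).2
  have hT' : ∀ y ∈ X.feasible, (∀ i, T i (y i) ≠ ∞) ∧
      ∑ i, (T i (y i)).toReal ≤ M.revenue G / μ := by
    intro y hy
    have h := hM G hG y hy
    change (μ : EReal) * ((∑ i, T i (y i) : ℝ≥0∞) : EReal) ≤ _ at h
    have hfin : ∑ i, T i (y i) ≠ ∞ := by
      intro htop
      rw [htop, EReal.coe_ennreal_top, EReal.coe_mul_top_of_pos hμ0, top_le_iff] at h
      exact EReal.coe_ne_top _ h
    have hfin' : ∀ i, T i (y i) ≠ ∞ := fun i => (ENNReal.sum_ne_top.1 hfin) i (Finset.mem_univ i)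
    refine ⟨hfin', ?_⟩
    rw [← ENNReal.toReal_sum fun i _ => hfin' i, le_div_iff₀ hμ0, mul_comm]
    rw [← ENNReal.ofReal_toReal hfin, EReal.coe_ennreal_ofReal,
      max_eq_left ENNReal.toReal_nonneg, ← EReal.coe_mul, EReal.coe_le_coe_iff] at h
    exact h
  -- Virtual value covering, summed over the agents.
  have hpt : ∀ᵐ ω ∂G, ∀ x ∈ convexHull ℝ X.feasible,
      (1 - (Real.exp 1)⁻¹) * ∑ i, φ i (ω.1 i) * x i
        ≤ ∑ i, φ i (ω.1 i) * M.interimAlloc G i (ω.2 i) + M.revenue G / μ := by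
    filter_upwards [ae_all_iff.2 fun i => (hagent i).2] with ω hω
    -- The claim is linear in `x`, so it suffices to show it for feasible allocations.
    have hconv : Convex ℝ {x : ι → ℝ | (1 - (Real.exp 1)⁻¹) * ∑ i, φ i (ω.1 i) * x i
        ≤ ∑ i, φ i (ω.1 i) * M.interimAlloc G i (ω.2 i) + M.revenue G / μ} := by
      refine convex_halfSpace_le ⟨fun x y => ?_, fun t x => ?_⟩ _
      · simp only [Pi.add_apply, mul_add, Finset.sum_add_distrib]
      · simp only [Pi.smul_apply, smul_eq_mul, Finset.mul_sum]
        exact Finset.sum_congr rfl fun i _ => by ring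
    refine fun x hx => convexHull_min (fun y hy => ?_) hconv hx
    obtain ⟨hfin, hsum⟩ := hT' y hy
    have hi : ∀ i, (1 - (Real.exp 1)⁻¹) * (φ i (ω.1 i) * y i)
        ≤ φ i (ω.1 i) * M.interimAlloc G i (ω.2 i) + (T i (y i)).toReal := by
      intro i
      have hφ0 : 0 ≤ φ i (ω.1 i) := le_max_right _ _
      rcases hX y hy i with h0 | h0
      · rw [h0, mul_zero, mul_zero]
        exact add_nonneg (mul_nonneg hφ0 (Mechanism.interimAlloc_nonneg i _))
          ENNReal.toReal_nonneg
      · have hfi := hfin i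
        rw [h0] at hfi ⊢
        rw [mul_one]
        exact hω i hfi
    have := Finset.sum_le_sum fun i (_ : i ∈ Finset.univ) => hi i
    rw [← Finset.mul_sum, Finset.sum_add_distrib] at this
    exact this.trans (by gcongr)
  have hmechsum : Integrable (fun ω => ∑ i, φ i (ω.1 i) * M.interimAlloc G i (ω.2 i)) G :=
    integrable_finsetSum _ fun i _ => hmech i
  have hE := integral_mono_ae ((integrable_finsetSum _ fun i _ => hdir i).const_mul _)
    (hmechsum.add (integrable_const _))
    (hpt.mono fun ω hω => hω _ (D.alloc_mem ω.1))
  have hsum2 : ∑ i, ∫ ω, φ i (ω.1 i) * M.interimAlloc G i (ω.2 i) ∂G ≤ M.revenue G := by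
    rw [Mechanism.revenue_eq_sum hG]
    exact Finset.sum_le_sum fun i _ => (hagent i).1
  have hsum3 : ∫ v, ∑ i, D.pay v i ∂(G.map Prod.fst)
      ≤ ∑ i, ∫ ω, φ i (ω.1 i) * D.alloc ω.1 i ∂G := by
    rw [integral_finsetSum _ fun i _ => hDint i]
    refine Finset.sum_le_sum fun i _ => ?_
    have hev : Measurable fun u : ι → ℝ => u i := measurable_pi_apply i
    have : IsProbabilityMeasure ((G.map Prod.fst).map fun u => u i) :=
      Measure.isProbabilityMeasure_map hev.aemeasurable
    have hri : IsRegularWith ((G.map Prod.fst).map fun u => u i) (I i) (f i) := by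
      rw [hmap]; exact hregw i
    refine (D.integral_pay_le (iIndepFun_values hG) hDint hbic hir i hri
      ((integrable_map_measure hev.aestronglyMeasurable measurable_fst.aemeasurable).2
        (hmean i))).trans_eq ?_
    have e := integral_map (μ := G) measurable_fst.aemeasurable
      (f := fun v : ι → ℝ =>
        max (virtualValue ((G.map Prod.fst).map fun u => u i) (f i) (v i)) 0 * D.alloc v i)
      (((hri.measurable_virtualValue.max measurable_const).comp hev).mul
        (D.measurable_alloc i)).aestronglyMeasurable
    rw [e]
    simp only [hmap, hφ]
  rw [integral_const_mul, integral_finsetSum _ fun i _ => hdir i,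
    integral_add' hmechsum (integrable_const _), integral_finsetSum _ fun i _ => hmech i,
    integral_const, probReal_univ, one_smul] at hE
  have he2 : (Real.exp 1)⁻¹ ≤ 1 := inv_le_one_of_one_le₀ he1
  have h7 := mul_le_mul_of_nonneg_left hsum3 (sub_nonneg.2 he2)
  have h8 : M.revenue G ≤ M.revenue G / μ := by
    rw [le_div_iff₀ hμ0]; exact mul_le_of_le_one_right hrev0 hμ
  have h9 : (1 - (Real.exp 1)⁻¹) * ∫ v, ∑ i, D.pay v i ∂(G.map Prod.fst)
      ≤ 2 * (M.revenue G / μ) := by linarith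
  have h10 : c = (1 - (Real.exp 1)⁻¹) * (μ / 2) := by rw [hc]; field_simp
  calc (∫ v, ∑ i, D.pay v i ∂(G.map Prod.fst)) * c
      = (μ / 2) * ((1 - (Real.exp 1)⁻¹) * ∫ v, ∑ i, D.pay v i ∂(G.map Prod.fst)) := by
        rw [h10]; ring
    _ ≤ (μ / 2) * (2 * (M.revenue G / μ)) := by gcongr
    _ = M.revenue G := by field_simp
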